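/- Let $\mathbb{T}=abacabaabacab\cdots$ be the Tribonacci sequence, the fixed point of $\sigma:a\mapsto ab,\ b\mapsto ac,\ c\mapsto a$, with positions numbered from $1$; let $T_m=\sigma^m(a)$ and $t_m=|T_m|$ ($m\ge 0$). For a nonempty word $\omega$, let $\omega_p$ be its $p$-th occurrence in $\mathbb{T}$ and $P(\omega,p)$ the position of the last letter of $\omega_p$. A square occurrence is a pair $(\omega,p)$ such that $\omega_{p+1}$ starts right after the end of $\omega_p$; it ends at position $P(\omega,p+1)$. Let $b(n)$ be the number of square occurrences ending at position $n$, and $B(n)$ the number of those ending at a position $\le n$. Let $k_0=0$, $k_1=k_2=1$, $k_m=k_{m-1}+k_{m-2}+k_{m-3}-1$ for $m\ge3$; for $m\ge 4$ let $K_m$ be the last letter of $T_{m-1}$ followed by the prefix of $T_{m-3}$ of length $k_m-1$, and put $P=P(K_m,1)$, $$\Gamma_{1,m}=[P+t_{m-1}-t_{m-2},\dots,P+t_{m-1}-1],\quad \Gamma_{2,m}=[P-t_m+2t_{m-1},\dots,P+t_{m-1}-t_{m-2}-1],\quad \Gamma_{3,m}=[P,\dots,P-t_m+2t_{m-1}-1]$$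 (these are the blocks $\Gamma_{j,m,1}$). For a vector $\Gamma$ of positions let $b(\Gamma)$ be the vector of the values of $b$ and $\sum b(\Gamma)$ the sum of its entries. Let $\Phi_m=\sum_{j=1}^3\sum b(\Gamma_{j,m})$ and $S_{j,m}(n)=\sum_{i=\min\Gamma_{j,m}}^{n}b(i)$. In formulas at level $m$ write $x=t_m$, $y=t_{m-1}$, $z=t_{m-2}$. Then the following hold. **(0)** $B(n)=\sum_{i=1}^n b(i)$ for all $n$. For $m\ge4$: $\min\Gamma_{3,m}=\theta^1_m:=\frac{x+z-1}2$; $\max\Gamma_{3,m}+1=\min\Gamma_{2,m}=\theta^4_m:=\frac{-x+4y+z-1}2$; $\max\Gamma_{2,m}+1=\min\Gamma_{1,m}=\theta^7_m:=\frac{x+2y-z-1}2$; $\max\Gamma_{1,m}+1=\theta^{10}_m:=\frac{x+2y+z-1}2$; and $|\Gamma_{1,m}|=t_{m-2}$, $|\Gamma_{2,m}|=t_{m-3}$, $|\Gamma_{3,m}|=t_{m-4}$. Every $n\ge 8$ lies in exactly one block $\Gamma_{j,m}$ ($1\le j\le 3$, $m\ge4$). If $n\in\Gamma_{j,m}$ and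 $n\ge52$, then $m\ge7$; if $n\in\Gamma_{2,m}$ and $n\ge32$, then $m\ge6$; if $n\in\Gamma_{1,m}$ and $n\ge21$, then $m\ge5$. **(1) Recursive description of $b$.** $b(i)=0$ for $i\le7$, $b([8])=[1]$, $b([9,10])=[0,1]$, $b([11,\dots,14])=[0,0,0,1]$, $b([15,16])=[1,1]$, $b([17,\dots,20])=[0,0,1,1]$, $b([28,\dots,31])=[1,1,1,1]$; and, with $V_m=[b(\Gamma_{3,m}),b(\Gamma_{2,m}),b(\Gamma_{1,m})]$ (concatenation), $$b(\Gamma_{1,m})=V_{m-1}+[\underbrace{0,\dots,0}_{t_{m-2}-k_m+1},\underbrace{1,\dots,1}_{k_m-1}]\ (m\ge5),\qquad b(\Gamma_{2,m})=V_{m-2}+[\underbrace{0,\dots,0}_{t_{m-3}-k_m+1},\underbrace{1,\dots,1}_{k_m-1}]\ (m\ge6),$$ $$b(\Gamma_{3,m})=V_{m-3}+[\underbrace{1,\dots,1}_{t_{m-4}-k_{m-3}+1},\underbrace{0,\dots,0}_{k_{m-3}-1}]\ (m\ge7).$$ **(2) Closed forms.** For $m\ge4$: - $\Phi_m=\frac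 m{22}(-5x+14y+4z)+\frac1{44}(67x-166y+5z)+\frac14$; - $\sum b(\Gamma_{1,m})=\frac m{22}(4x-9y+10z)+\frac1{44}(19x+36y-169z)-\frac14$; - $\sum b(\Gamma_{2,m})=\frac m{22}(10x-6y-19z)+\frac1{44}(-189x+156y+331z)-\frac14$; - $\sum b(\Gamma_{3,m})=\frac m{22}(-19x+29y+13z)+\frac1{44}(237x-358y-157z)+\frac34$; - $\sum_{i=4}^{m-1}\Phi_i=\frac m{44}(13x-10y+5z)+\frac2{11}(-8x+8y-7z)+\frac m4+2$; - $B(\max\Gamma_{3,m})=\frac m{44}(-25x+48y+31z)+\frac1{44}(173x-294y-213z)+\frac{m+11}4$; - $B(\max\Gamma_{2,m})=\frac m{44}(-5x+36y-7z)+\frac1{22}(-8x-69y+59z)+\frac{m+10}4$; - $B(\max\Gamma_{1,m})=\frac m{44}(3x+18y+13z)+\frac1{44}(3x-102y-51z)+\frac{m+9}4$. **(3) Reduction on $\Gamma_{3,m}$.** Let $m\ge7$, $\theta^2_m=\frac{-5x+10y+3z-1}2$, $\theta^3_m=\frac{-x+6y-3z-1}2$, $\eta^1_m=-2x+5y$.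 Then $\theta^2_m=\min\Gamma_{3,m}+|\Gamma_{3,m-3}|$, $\theta^3_m=\theta^2_m+|\Gamma_{2,m-3}|$, $\eta^1_m=\min\Gamma_{3,m}+t_{m-4}-k_{m-3}+1$, $\theta^3_m<\eta^1_m<\theta^4_m$, $\min\Gamma_{3,m}=\min\Gamma_{3,m-3}+t_{m-1}$, and for $n\in\Gamma_{3,m}$, with $n'=n-t_{m-1}$, $$S_{3,m}(n)=\begin{cases}S_{3,m-3}(n')+n-\min\Gamma_{3,m}+1,&n<\theta^2_m;\\ S_{2,m-3}(n')+\sum b(\Gamma_{3,m-3})+n-\min\Gamma_{3,m}+1,&\theta^2_m\le n<\theta^3_m;\\ S_{1,m-3}(n')+\sum b(\Gamma_{3,m-3})+\sum b(\Gamma_{2,m-3})+n-\min\Gamma_{3,m}+1,&\theta^3_m\le n<\eta^1_m;\\ S_{1,m-3}(n')+\sum b(\Gamma_{3,m-3})+\sum b(\Gamma_{2,m-3})+\frac{-5x+10y-z+1}2,&\text{otherwise.}\end{cases}$$ **(4) Reduction on $\Gamma_{2,m}$.** Let $m\ge6$, $\theta^5_m=\frac{3x-5z-1}2$, $\eta^2_m=2y-z$,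 $\theta^6_m=\frac{3x-2y-z-1}2$. Then $\theta^5_m=\min\Gamma_{2,m}+|\Gamma_{3,m-2}|$, $\theta^6_m=\theta^5_m+|\Gamma_{2,m-2}|$, $\eta^2_m=\min\Gamma_{2,m}+t_{m-3}-k_m+1$, $\theta^5_m<\eta^2_m\le\theta^6_m$, $\min\Gamma_{2,m}=\min\Gamma_{3,m-2}+t_{m-1}$, and for $n\in\Gamma_{2,m}$, with $n'=n-t_{m-1}$, $$S_{2,m}(n)=\begin{cases}S_{3,m-2}(n'),&n<\theta^5_m;\\ S_{2,m-2}(n')+\sum b(\Gamma_{3,m-2}),&\theta^5_m\le n<\eta^2_m;\\ S_{2,m-2}(n')+\sum b(\Gamma_{3,m-2})+n-\eta^2_m+1,&\eta^2_m\le n<\theta^6_m;\\ S_{1,m-2}(n')+\sum b(\Gamma_{3,m-2})+\sum b(\Gamma_{2,m-2})+n-\eta^2_m+1,&\text{otherwise.}\end{cases}$$ **(5) Reduction on $\Gamma_{1,m}$.** Let $m\ge5$, $\theta^8_m=\frac{x+3z-1}2$, $\theta^9_m=\frac{-x+4y+3z-1}2$, $\eta^3_m=2y$. Then $\theta^8_m=\min\Gamma_{1,m}+|\Gamma_{3,m-1}|$,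 $\theta^9_m=\theta^8_m+|\Gamma_{2,m-1}|$, $\eta^3_m=\min\Gamma_{1,m}+t_{m-2}-k_m+1$, $\theta^9_m<\eta^3_m<\theta^{10}_m$, $\min\Gamma_{1,m}=\min\Gamma_{3,m-1}+t_{m-1}$, and for $n\in\Gamma_{1,m}$, with $n'=n-t_{m-1}$, $$S_{1,m}(n)=\begin{cases}S_{3,m-1}(n'),&n<\theta^8_m;\\ S_{2,m-1}(n')+\sum b(\Gamma_{3,m-1}),&\theta^8_m\le n<\theta^9_m;\\ S_{1,m-1}(n')+\sum b(\Gamma_{3,m-1})+\sum b(\Gamma_{2,m-1}),&\theta^9_m\le n<\eta^3_m;\\ S_{1,m-1}(n')+\sum b(\Gamma_{3,m-1})+\sum b(\Gamma_{2,m-1})+n-\eta^3_m+1,&\text{otherwise.}\end{cases}$$ **(6) Algorithm B.** For $n\in\Gamma_{j,m}$, $m\ge4$: $B(n)=B(\min\Gamma_{j,m}-1)+S_{j,m}(n)$. Evaluating $b(n)$ by the recursion (1), starting from the listed values, gives $b(n)$ correctly for every $n\ge 0$. The following algorithm returns $B(n)$ for every $n\ge0$: if $n\le51$, compute $\sum_{i=1}^n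 b(i)$ by (1); if $n\ge52$, find by upward search from $m=4$ the $j,m$ with $n\in\Gamma_{j,m}$, evaluate $B(\min\Gamma_{j,m}-1)$ by (2) (it is $B$ at the maximum of the preceding block $\Gamma_{2,m}$, $\Gamma_{3,m}$, $\Gamma_{1,m-1}$ for $j=1,2,3$), evaluate $S_{j,m}(n)$ by repeated reduction (3)–(5) with the complete block sums taken from (2), down to a block on which $b$ is listed in (1), and add. It is fast: the number of its search and reduction steps is $O(\log n)$ as $n\to\infty$, each step using a bounded number of arithmetic operations and comparisons. -/

import Mathlib

/-!
Since `𝕋` contains no fourth powers, the two halves of a square are consecutive occurrences of its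
root, so `b n` counts the lengths `l` for which the last `2l` letters up to `n` form a square.

For each `M`, the words `σ^M(u)` with `u` a long factor of `𝕋` all begin with one word, of length
`lcpLength M = 0, 1, 3, 7, 14, …`. By desubstitution, every factor of period `l` and length at least
`2l - 1` lies in some `σ^M(x)`, `x` a letter of `𝕋` with `|σ^M(x)| = l`, followed by this common
word. Now `𝕋` without its prefix `T_{m-1}` begins with that word for `M = m - 1`, as `𝕋` itself
does. So moving `n ∈ Γ_{j,m}` back by `t_{m-1}` preserves all squares ending at `n` except those
that begin inside `T_{m-1}`; by the description of repetitions there is at most one of these, and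
within the block its presence changes only once, at `η`. This is the recursion for `b`.

The blocks of level `m` together end at a position of the form `lcpLength r`. Summing the recursion
gives a linear recurrence for the values of `B` there, which the closed forms solve. Each step of
the recursion lowers the level, and `t_m` grows exponentially in `m`, hence the logarithmic number
of steps.
-/

namespace TribSq

/-- The alphabet. -/
inductive Letter
  | a
  | b
  | c
  deriving DecidableEq

/-- The substitution `a ↦ ab`, `b ↦ ac`, `c ↦ a` on letters. -/
def sub : Letter → List Letter
  | .a => [.a, .b]
  | .b => [.a, .c]
  | .c => [.a]

/-- `T_m = σ^m(a)`. -/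
def word (m : ℕ) : List Letter :=
  (fun w : List Letter => w.flatMap sub)^[m] [Letter.a]

/-- The Tribonacci numbers `t_m = |T_m|`: `1, 2, 4, 7, 13, 24, …`. -/
def t (m : ℕ) : ℕ := (word m).length

/-- The Tribonacci sequence, the fixed point of the substitution, positions numbered from `1`.
Every `T_m` is a prefix of it and `|T_n| ≥ n + 1`, so its `n`-th letter is the `n`-th letter
of `T_n`. The value at position `0` is never used. -/
def trib (n : ℕ) : Letter := (word n).getD (n - 1) Letter.a

/-- The factor of the Tribonacci sequence occupying the positions `i, …, j`. -/
def factor (i j : ℕ) : List Letter := (List.range' i (j + 1 - i)).map trib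

/-- The word `w` occurs in the Tribonacci sequence with its last letter at position `n`. -/
def EndsAt (w : List Letter) (n : ℕ) : Prop :=
  w.length ≤ n ∧ factor (n - w.length + 1) n = w

/-- The `p`-th occurrence of `w` (counted from `1`) has its last letter at position `n`. -/
def IsOcc (w : List Letter) (p n : ℕ) : Prop :=
  EndsAt w n ∧ {i : ℕ | i ≤ n ∧ EndsAt w i}.ncard = p

/-- `P(w, p)`: the position of the last letter of the `p`-th occurrence of `w`. -/
noncomputable def pos (w : List Letter) (p : ℕ) : ℕ := sInf {n : ℕ | IsOcc w p n}

/-- `w_p w_{p+1}` is a square ending at position `n`: the `p`-th and the `(p+1)`-st occurrence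
of the nonempty word `w` are adjacent and the latter ends at `n`. -/
def SquareAt (w : List Letter) (p n : ℕ) : Prop :=
  w ≠ [] ∧ ∃ e : ℕ, IsOcc w p e ∧ IsOcc w (p + 1) (e + w.length) ∧ e + w.length = n

/-- `b(n)`: the number of square occurrences ending at position `n`. -/
noncomputable def b (n : ℕ) : ℕ := {x : List Letter × ℕ | SquareAt x.1 x.2 n}.ncard

/-- `B(n)`: the number of square occurrences in the prefix of length `n`. -/
noncomputable def B (n : ℕ) : ℕ :=
  {x : List Letter × ℕ | ∃ e ≤ n, SquareAt x.1 x.2 e}.ncard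

/-- The kernel numbers. -/
def k : ℕ → ℕ
  | 0 => 0
  | 1 => 1
  | 2 => 1
  | m + 3 => k (m + 2) + k (m + 1) + k m - 1

/-- The kernel words `K_m`, for `m ≥ 1`: `K_1 = a`, `K_2 = b`, `K_3 = c`, and for `m ≥ 4` the
last letter of `T_{m-1}` followed by the prefix of `T_{m-3}` of length `k_m - 1`. -/
def kernel : ℕ → List Letter
  | 0 => []
  | 1 => [.a]
  | 2 => [.b]
  | 3 => [.c]
  | m + 4 => (word (m + 3)).getLastD .a :: (word (m + 1)).take (k (m + 4) - 1)

/-- The index `j ∈ {1, 2, 3}` of a block. -/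
inductive Idx
  | one
  | two
  | three
  deriving DecidableEq

/-- The least element of the block `Γ_{j,m,p}`, for `m ≥ 4`. -/
noncomputable def gMin (j : Idx) (m p : ℕ) : ℕ :=
  match j with
  | .one => pos (kernel m) p + t (m - 1) - t (m - 2)
  | .two => pos (kernel m) p + 2 * t (m - 1) - t m
  | .three => pos (kernel m) p

/-- The greatest element of the block `Γ_{j,m,p}`, for `m ≥ 4`. -/
noncomputable def gMax (j : Idx) (m p : ℕ) : ℕ :=
  match j with
  | .one => pos (kernel m) p + t (m - 1) - 1
  | .two => pos (kernel m) p + t (m - 1) - t (m - 2) - 1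
  | .three => pos (kernel m) p + 2 * t (m - 1) - t m - 1

/-- The block `Γ_{j,m,p} = [min, …, max]`, a vector of consecutive positions. -/
noncomputable def block (j : Idx) (m p : ℕ) : List ℕ :=
  List.range' (gMin j m p) (gMax j m p + 1 - gMin j m p)

/-- The vector `b(Γ_{j,m,1})`. -/
noncomputable def bVec (j : Idx) (m : ℕ) : List ℕ := (block j m 1).map b

/-- The concatenated vector `[b(Γ_{3,m,1}), b(Γ_{2,m,1}), b(Γ_{1,m,1})]`. -/
noncomputable def bCat (m : ℕ) : List ℕ := bVec .three m ++ bVec .two m ++ bVec .one m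

/-- `Σ b(Γ_{j,m,1})`. -/
noncomputable def bSum (j : Idx) (m : ℕ) : ℕ := (bVec j m).sum

/-- `Φ_m`. -/
noncomputable def Phi (m : ℕ) : ℕ := bSum .three m + bSum .two m + bSum .one m

/-- The partial block sum `Σ_{i = min Γ_{j,m,1}}^{n} b(i)`. -/
noncomputable def part (j : Idx) (m n : ℕ) : ℚ :=
  ∑ i ∈ Finset.Icc (gMin j m 1) n, (b i : ℚ)

/-- The data `m`, `x = t_m`, `y = t_{m-1}`, `z = t_{m-2}` that the closed forms and
the algorithm work with. -/
structure Trip where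
  m : ℕ
  x : ℤ
  y : ℤ
  z : ℤ

namespace Trip

/-- The data at level `m`, for `m ≥ 2`. -/
def ofLevel (m : ℕ) : Trip := ⟨m, t m, t (m - 1), t (m - 2)⟩

/-- From level `m` to level `m + 1`. -/
def up (s : Trip) : Trip := ⟨s.m + 1, s.x + s.y + s.z, s.x, s.y⟩

/-- From level `m` to level `m - 1`. -/
def down (s : Trip) : Trip := ⟨s.m - 1, s.y, s.z, s.x - s.y - s.z⟩

/-! The thresholds; all divisions by `2` are exact. -/

def θ1 (s : Trip) : ℤ := (s.x + s.z - 1) / 2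
def θ2 (s : Trip) : ℤ := (-5 * s.x + 10 * s.y + 3 * s.z - 1) / 2
def θ3 (s : Trip) : ℤ := (-s.x + 6 * s.y - 3 * s.z - 1) / 2
def η1 (s : Trip) : ℤ := -2 * s.x + 5 * s.y
def θ4 (s : Trip) : ℤ := (-s.x + 4 * s.y + s.z - 1) / 2
def θ5 (s : Trip) : ℤ := (3 * s.x - 5 * s.z - 1) / 2
def η2 (s : Trip) : ℤ := 2 * s.y - s.z
def θ6 (s : Trip) : ℤ := (3 * s.x - 2 * s.y - s.z - 1) / 2
def θ7 (s : Trip) : ℤ := (s.x + 2 * s.y - s.z - 1) / 2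
def θ8 (s : Trip) : ℤ := (s.x + 3 * s.z - 1) / 2
def θ9 (s : Trip) : ℤ := (-s.x + 4 * s.y + 3 * s.z - 1) / 2
def η3 (s : Trip) : ℤ := 2 * s.y
def θ10 (s : Trip) : ℤ := (s.x + 2 * s.y + s.z - 1) / 2

/-- The expression `(m/d) (a₁ x + a₂ y + a₃ z) + (1/e) (c₁ x + c₂ y + c₃ z)`. -/
def form (s : Trip) (d a₁ a₂ a₃ e c₁ c₂ c₃ : ℚ) : ℚ :=
  (s.m : ℚ) / d * (a₁ * s.x + a₂ * s.y + a₃ * s.z) + 1 / e * (c₁ * s.x + c₂ * s.y + c₃ * s.z)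

/-- The closed form of `Φ_m`. -/
def phiForm (s : Trip) : ℚ := s.form 22 (-5) 14 4 44 67 (-166) 5 + 1 / 4

/-- The closed form of `Σ b(Γ_{j,m,1})`. -/
def sumForm (s : Trip) : Idx → ℚ
  | .one => s.form 22 4 (-9) 10 44 19 36 (-169) - 1 / 4
  | .two => s.form 22 10 (-6) (-19) 44 (-189) 156 331 - 1 / 4
  | .three => s.form 22 (-19) 29 13 44 237 (-358) (-157) + 3 / 4

/-- The closed form of `Σ_{j=4}^{m-1} Φ_j`. -/
def phiSumForm (s : Trip) : ℚ :=
  s.form 44 13 (-10) 5 (11 / 2) (-8) 8 (-7) + (s.m : ℚ) / 4 + 2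

/-- The closed form of `B(max Γ_{j,m,1})`. -/
def maxForm (s : Trip) : Idx → ℚ
  | .one => s.form 44 3 18 13 44 3 (-102) (-51) + ((s.m : ℚ) + 9) / 4
  | .two => s.form 44 (-5) 36 (-7) 22 (-8) (-69) 59 + ((s.m : ℚ) + 10) / 4
  | .three => s.form 44 (-25) 48 31 44 173 (-294) (-213) + ((s.m : ℚ) + 11) / 4

/-- The index `j` of the block of level `m` that contains `n`, for `θ1 ≤ n < θ10`. -/
def idx (s : Trip) (n : ℤ) : Idx :=
  if n < s.θ4 then .three else if n < s.θ7 then .two else .one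

end Trip

/-! ### The algorithm

Every procedure returns its result and the number of search and reduction steps performed. One
step uses a bounded number of arithmetic operations and comparisons, and the data for level
`m ± 1` is obtained from that for level `m` by additions and subtractions. -/

/-- The initial values of `b` on the blocks `Γ_{3,4,1}`, `Γ_{2,4,1}`, `Γ_{1,4,1}`, `Γ_{3,5,1}`,
`Γ_{2,5,1}`, `Γ_{3,6,1}`, which are `[8]`, `[9,10]`, `[11,…,14]`, `[15,16]`, `[17,…,20]`,
`[28,…,31]`. -/
def initB (n : ℤ) : ℤ :=
  if n ∈ [8, 10, 14, 15, 16, 19, 20, 28, 29, 30, 31] then 1 else 0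

/-- The sum of the initial values at the positions `lo, …, n`. -/
def initSum (lo n : ℤ) : ℚ :=
  ((List.range (n + 1 - lo).toNat).map fun i => (initB (lo + i) : ℚ)).sum

/-- Search upwards for the level whose three blocks contain `n`, with at most `fuel` steps. -/
def search : ℕ → Trip → ℤ → Trip × ℕ
  | 0, s, _ => (s, 0)
  | fuel + 1, s, n =>
    if n < s.θ10 then (s, 0)
    else
      let r := search fuel s.up n
      (r.1, r.2 + 1)

/-- The level `m ≥ 4` with `n` in one of the blocks `Γ_{j,m,1}`, for `n ≥ 8`. -/
def level (n : ℕ) : Trip × ℕ := search n ⟨4, 13, 7, 4⟩ n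

/-- The value `b(n)` for `n` in the block `j` of the level `s`, by the recursive description. -/
def bBlock (j : Idx) (s : Trip) (n : ℤ) : ℤ × ℕ :=
  match j with
  | .one =>
    if s.m ≤ 4 then (initB n, 0)
    else
      let s' := s.down
      let r := bBlock (s'.idx (n - s.y)) s' (n - s.y)
      (r.1 + (if s.η3 ≤ n then 1 else 0), r.2 + 1)
  | .two =>
    if s.m ≤ 5 then (initB n, 0)
    else
      let s' := s.down.down
      let r := bBlock (s'.idx (n - s.y)) s' (n - s.y)
      (r.1 + (if s.η2 ≤ n then 1 else 0), r.2 + 1)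
  | .three =>
    if s.m ≤ 6 then (initB n, 0)
    else
      let s' := s.down.down.down
      let r := bBlock (s'.idx (n - s.y)) s' (n - s.y)
      (r.1 + (if n < s.η1 then 1 else 0), r.2 + 1)
termination_by s.m
decreasing_by all_goals (simp only [Trip.down]; omega)

/-- The recursive computation of `b(n)`. -/
def bAlg (n : ℕ) : ℤ × ℕ :=
  if n ≤ 7 then (0, 0)
  else
    let s := level n
    let r := bBlock (s.1.idx n) s.1 n
    (r.1, s.2 + r.2)

/-- The recursive computation of the partial block sum `Σ_{i = min Γ_{j,m,1}}^{n} b(i)`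
for `n` in the block `j` of the level `s`. -/
def partAlg (j : Idx) (s : Trip) (n : ℤ) : ℚ × ℕ :=
  match j with
  | .three =>
    if s.m ≤ 6 then (initSum s.θ1 n, 0)
    else
      let s' := s.down.down.down
      let n' := n - s.y
      if n < s.θ2 then
        let r := partAlg .three s' n'
        (r.1 + n - s.θ1 + 1, r.2 + 1)
      else if n < s.θ3 then
        let r := partAlg .two s' n'
        (r.1 + s'.sumForm .three + n - s.θ1 + 1, r.2 + 1)
      else if n < s.η1 then
        let r := partAlg .one s' n'
        (r.1 + s'.sumForm .three + s'.sumForm .two + n - s.θ1 + 1, r.2 + 1)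
      else
        let r := partAlg .one s' n'
        (r.1 + s'.sumForm .three + s'.sumForm .two
          + (-5 * (s.x : ℚ) + 10 * s.y - s.z + 1) / 2, r.2 + 1)
  | .two =>
    if s.m ≤ 5 then (initSum s.θ4 n, 0)
    else
      let s' := s.down.down
      let n' := n - s.y
      if n < s.θ5 then
        let r := partAlg .three s' n'
        (r.1, r.2 + 1)
      else if n < s.η2 then
        let r := partAlg .two s' n'
        (r.1 + s'.sumForm .three, r.2 + 1)
      else if n < s.θ6 then
        let r := partAlg .two s' n'
        (r.1 + s'.sumForm .three + n - s.η2 + 1, r.2 + 1)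
      else
        let r := partAlg .one s' n'
        (r.1 + s'.sumForm .three + s'.sumForm .two + n - s.η2 + 1, r.2 + 1)
  | .one =>
    if s.m ≤ 4 then (initSum s.θ7 n, 0)
    else
      let s' := s.down
      let n' := n - s.y
      if n < s.θ8 then
        let r := partAlg .three s' n'
        (r.1, r.2 + 1)
      else if n < s.θ9 then
        let r := partAlg .two s' n'
        (r.1 + s'.sumForm .three, r.2 + 1)
      else if n < s.η3 then
        let r := partAlg .one s' n'
        (r.1 + s'.sumForm .three + s'.sumForm .two, r.2 + 1)
      else
        let r := partAlg .one s' n'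
        (r.1 + s'.sumForm .three + s'.sumForm .two + n - s.η3 + 1, r.2 + 1)
termination_by s.m
decreasing_by all_goals (simp only [Trip.down]; omega)

/-- The closed form of `B(min Γ_{j,m,1} - 1)`: the greatest element of the preceding block
is `max Γ_{2,m,1}`, `max Γ_{3,m,1}`, `max Γ_{1,m-1,1}` for `j = 1, 2, 3`. -/
def beforeForm (j : Idx) (s : Trip) : ℚ :=
  match j with
  | .one => s.maxForm .two
  | .two => s.maxForm .three
  | .three => s.down.maxForm .one

/-- The algorithm for `B(n)`. -/
def algB (n : ℕ) : ℚ × ℕ :=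
  if n ≤ 51 then
    (∑ i ∈ Finset.Icc 1 n, ((bAlg i).1 : ℚ), ∑ i ∈ Finset.Icc 1 n, ((bAlg i).2 + 1))
  else
    let s := level n
    let j := s.1.idx n
    let r := partAlg j s.1 n
    (beforeForm j s.1 + r.1, s.2 + r.2)

end TribSq

namespace TribSq

/-! ### Repeated factors of a sequence -/

section SameFactor

variable {α : Type*} {v : ℕ → α} {p q r m n s l j : ℕ}

/-- The factors of length `n` of the sequence `v` that begin at the positions `p` and `q` coincide;
positions are numbered from `0`. In particular `SameFactor v s (s + l) q` says that the factor of
length `l + q` beginning at `s` has period `l`. -/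
def SameFactor (v : ℕ → α) (p q n : ℕ) : Prop := ∀ i < n, v (p + i) = v (q + i)

namespace SameFactor

lemma symm (h : SameFactor v p q n) : SameFactor v q p n := fun i hi => (h i hi).symm

lemma trans (h : SameFactor v p q n) (h' : SameFactor v q r n) : SameFactor v p r n :=
  fun i hi => (h i hi).trans (h' i hi)

lemma mono (h : SameFactor v p q n) (hmn : m ≤ n) : SameFactor v p q m :=
  fun i hi => h i (hi.trans_le hmn)

lemma head (h : SameFactor v p q n) (hn : 0 < n) : v p = v q := h 0 hn

lemma drop (h : SameFactor v p q n) (hmn : m + r ≤ n) : SameFactor v (p + m) (q + m) r :=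
  fun i hi => by simpa only [add_assoc] using h (m + i) (by omega)

lemma append (h : SameFactor v p q m) (h' : SameFactor v (p + m) (q + m) n) :
    SameFactor v p q (m + n) := by
  intro i hi
  by_cases him : i < m
  · exact h i him
  · obtain ⟨i, rfl⟩ := Nat.exists_eq_add_of_le (not_lt.1 him)
    simpa only [add_assoc] using h' i (by omega)

end SameFactor

lemma sameFactor_one : SameFactor v p q 1 ↔ v p = v q := by simp [SameFactor]

lemma sameFactor_succ : SameFactor v p q (n + 1) ↔ SameFactor v p q n ∧ v (p + n) = v (q + n) :=
  Nat.forall_lt_succ_right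

lemma sameFactor_succ' :
    SameFactor v p q (n + 1) ↔ v p = v q ∧ SameFactor v (p + 1) (q + 1) n := by
  simp only [SameFactor, Nat.forall_lt_succ_left, add_zero, add_right_comm _ 1, add_assoc]

lemma SameFactor.period_of_inner_occurrence (h : SameFactor v s (s + l) l)
    (hj : SameFactor v s (s + j) l) (hjl : j ≤ l) : SameFactor v s (s + j) (l + (l - j)) := by
  have shift : SameFactor v (s + j) (s + j + l) (l - j) := by
    simpa only [add_right_comm] using h.drop (m := j) (r := l - j) (by omega)
  have hl := (h.mono (Nat.sub_le l j)).symm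
  exact hj.append ((hl.trans (hj.mono (Nat.sub_le l j))).trans shift)

theorem SameFactor.not_inner_occurrence
    (fourthPowerFree : ∀ l, 0 < l → ¬ SameFactor v s (s + l) (3 * l))
    (h : SameFactor v s (s + l) l) (hj : 0 < j) (hjl : j < l) : ¬ SameFactor v s (s + j) l := by
  intro hinner
  have period := h.period_of_inner_occurrence hinner hjl.le
  obtain hle | hle : 2 * j ≤ l ∨ 2 * (l - j) ≤ l := by omega
  · exact fourthPowerFree j hj (period.mono (by omega))
  · have hinner' : SameFactor v s (s + (l - j)) l := by
      have := period.drop (m := l - j) (r := l) (by omega)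
      rw [show s + j + (l - j) = s + l by omega] at this
      exact h.trans this.symm
    exact fourthPowerFree (l - j) (by omega)
      ((h.period_of_inner_occurrence hinner' (by omega)).mono (by omega))

end SameFactor

lemma exists_mem_Ico_of_strictMono {f : ℕ → ℕ} (hf : StrictMono f) {i : ℕ} (h0 : f 0 ≤ i) :
    ∃ n, f n ≤ i ∧ i < f (n + 1) := by
  induction i, h0 using Nat.le_induction with
  | base => exact ⟨0, le_rfl, hf (Nat.lt_add_one 0)⟩
  | succ i _ ih =>
    obtain ⟨n, hn, hn'⟩ := ih
    obtain h | h := (Nat.succ_le_of_lt hn').lt_or_eq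
    · exact ⟨n, by omega, h⟩
    · have := hf (Nat.lt_add_one (n + 1))
      exact ⟨n + 1, h.ge, by omega⟩

/-! ### The substitution and the prefixes of the Tribonacci sequence -/

/-- The Tribonacci sequence with positions numbered from `0`. -/
def letter (i : ℕ) : Letter := trib (i + 1)

/-- The factor of length `n` of the Tribonacci sequence that begins at the position `s`, numbered
from `0`; in particular `factorAt 0 n` is the prefix of length `n`. -/
def factorAt (s n : ℕ) : List Letter := (List.range n).map fun i => letter (s + i)

/-- The length of the image under the substitution of the prefix of length `n`, which is also the
position at which the image of the letter at position `n` begins. -/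
def imageLength (n : ℕ) : ℕ := ∑ i ∈ Finset.range n, (sub (letter i)).length

/-- The cyclic permutation `a ↦ b ↦ c ↦ a`; `rotate l` is the last letter of `sub l`. -/
def rotate : Letter → Letter
  | .a => .b
  | .b => .c
  | .c => .a

lemma rotate_injective : Function.Injective rotate := by
  intro l l' h
  cases l <;> cases l' <;> simp_all [rotate]

lemma word_succ (m : ℕ) : word (m + 1) = (word m).flatMap sub := by
  simp only [word, Function.iterate_succ_apply']

lemma word_add_three (m : ℕ) : word (m + 3) = word (m + 2) ++ word (m + 1) ++ word m := by
  induction m with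
  | zero => rfl
  | succ m ih =>
    rw [word_succ (m + 3), ih, List.flatMap_append, List.flatMap_append, ← word_succ,
      ← word_succ, ← word_succ, ← ih]

lemma t_add_three (m : ℕ) : t (m + 3) = t (m + 2) + t (m + 1) + t m := by
  simp only [t, word_add_three, List.length_append]

lemma t_pos (m : ℕ) : 0 < t m := by
  induction m using Nat.strong_induction_on with
  | _ m ih =>
    match m with
    | 0 | 1 | 2 => decide
    | m + 3 => rw [t_add_three]; exact Nat.add_pos_right _ (ih m (by omega))

lemma t_strictMono : StrictMono t := by
  refine strictMono_nat_of_lt_succ fun m => ?_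
  match m with
  | 0 | 1 | 2 => decide
  | m + 3 =>
    have := t_pos (m + 1)
    have := t_pos (m + 2)
    have h : t (m + 3 + 1) = t (m + 3) + t (m + 2) + t (m + 1) := t_add_three (m + 1)
    omega

lemma lt_t (m : ℕ) : m < t m := by
  induction m with
  | zero => exact t_pos 0
  | succ m ih => exact Nat.lt_of_le_of_lt ih (t_strictMono m.lt_add_one)

lemma prefix_flatMap_sub {v w : List Letter} (h : v <+: w) :
    v.flatMap sub <+: w.flatMap sub := by
  obtain ⟨r, rfl⟩ := h
  exact ⟨r.flatMap sub, List.flatMap_append.symm⟩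

lemma word_prefix {m n : ℕ} (h : m ≤ n) : word m <+: word n := by
  have succ (m : ℕ) : word m <+: word (m + 1) := by
    induction m with
    | zero => exact ⟨[Letter.b], rfl⟩
    | succ m ih => rw [word_succ m, word_succ (m + 1)]; exact prefix_flatMap_sub ih
  induction n, h using Nat.le_induction with
  | base => exact List.prefix_rfl
  | succ n _ ih => exact ih.trans (succ n)

lemma getElem_word {m i : ℕ} (h : i < (word m).length) : (word m)[i] = letter i := by
  have hi : i < (word (i + 1)).length := (Nat.lt_add_one i).trans (lt_t (i + 1))
  have hm := (word_prefix (le_max_left m (i + 1))).getElem h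
  have hi' := (word_prefix (le_max_right m (i + 1))).getElem hi
  rw [letter, trib, Nat.add_sub_cancel, List.getD_eq_getElem _ _ hi, hm, hi']

lemma length_factorAt (s n : ℕ) : (factorAt s n).length = n := by
  rw [factorAt, List.length_map, List.length_range]

lemma factorAt_eq_iff {s s' n : ℕ} : factorAt s n = factorAt s' n ↔ SameFactor letter s s' n := by
  simp only [factorAt, List.map_inj_left, List.mem_range, SameFactor]

lemma factorAt_succ (s n : ℕ) : factorAt s (n + 1) = factorAt s n ++ [letter (s + n)] := by
  simp only [factorAt, List.range_succ, List.map_append, List.map_cons, List.map_nil]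

lemma factorAt_succ' (s n : ℕ) : factorAt s (n + 1) = letter s :: factorAt (s + 1) n := by
  simp only [factorAt, List.range_succ_eq_map, List.map_cons, List.map_map, add_zero,
    Function.comp_def, Nat.succ_eq_add_one, ← add_assoc, add_right_comm s 1]

lemma take_factorAt (s : ℕ) {m n : ℕ} (h : m ≤ n) : (factorAt s n).take m = factorAt s m := by
  rw [factorAt, factorAt, ← List.map_take, List.take_range, min_eq_left h]

lemma word_eq_factorAt (m : ℕ) : word m = factorAt 0 (t m) :=
  List.ext_getElem (length_factorAt 0 _).symm fun i hi _ => by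
    rw [getElem_word hi]; simp [factorAt]

lemma imageLength_zero : imageLength 0 = 0 := rfl

lemma imageLength_succ (n : ℕ) :
    imageLength (n + 1) = imageLength n + (sub (letter n)).length :=
  Finset.sum_range_succ _ n

lemma length_flatMap_factorAt (n : ℕ) : ((factorAt 0 n).flatMap sub).length = imageLength n := by
  induction n with
  | zero => rfl
  | succ n ih => simp [factorAt_succ, imageLength_succ, ih]

lemma t_succ (m : ℕ) : t (m + 1) = imageLength (t m) := by
  rw [t, word_succ, word_eq_factorAt, length_flatMap_factorAt]

lemma flatMap_factorAt (n : ℕ) : (factorAt 0 n).flatMap sub = factorAt 0 (imageLength n) := by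
  have h : (factorAt 0 n).flatMap sub <+: factorAt 0 (t (n + 1)) := by
    rw [← word_eq_factorAt, word_succ, word_eq_factorAt, ← take_factorAt 0 (lt_t n).le]
    exact prefix_flatMap_sub (List.take_prefix _ _)
  have hle : imageLength n ≤ t (n + 1) := by
    simpa only [length_flatMap_factorAt, length_factorAt 0] using h.length_le
  rw [List.prefix_iff_eq_take.1 h, length_flatMap_factorAt, take_factorAt 0 hle]

lemma letter_imageLength_add {n j : ℕ} (h : j < (sub (letter n)).length) :
    letter (imageLength n + j) = (sub (letter n))[j] := by
  have hsplit :
      factorAt 0 (imageLength (n + 1)) = factorAt 0 (imageLength n) ++ sub (letter n) := by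
    rw [← flatMap_factorAt, ← flatMap_factorAt, factorAt_succ, List.flatMap_append, zero_add,
      List.flatMap_singleton]
  have hj : imageLength n + j < imageLength (n + 1) := by rw [imageLength_succ]; omega
  have hget := congrArg (·[imageLength n + j]?) hsplit
  simpa [factorAt, hj, h] using hget

lemma letter_imageLength (n : ℕ) : letter (imageLength n) = .a := by
  have := letter_imageLength_add (n := n) (j := 0) (by cases letter n <;> simp [sub])
  cases h : letter n <;> simpa [h, sub] using this

lemma imageLength_succ_of_ne_c {n : ℕ} (h : letter n ≠ .c) :
    imageLength (n + 1) = imageLength n + 2 := by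
  rw [imageLength_succ]; cases hn : letter n <;> simp_all [sub]

lemma imageLength_succ_of_eq_c {n : ℕ} (h : letter n = .c) :
    imageLength (n + 1) = imageLength n + 1 := by
  rw [imageLength_succ, h]; rfl

lemma letter_imageLength_add_one (n : ℕ) : letter (imageLength n + 1) = rotate (letter n) := by
  cases h : letter n
  case c => rw [← imageLength_succ_of_eq_c h, letter_imageLength, rotate]
  all_goals
    have := letter_imageLength_add (n := n) (j := 1) (by simp [h, sub])
    simpa [h, sub, rotate] using this

lemma letter_imageLength_succ_sub_one (n : ℕ) :
    letter (imageLength (n + 1) - 1) = rotate (letter n) := by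
  by_cases h : letter n = .c
  · rw [imageLength_succ_of_eq_c h, Nat.add_sub_cancel, letter_imageLength, h, rotate]
  · rw [imageLength_succ_of_ne_c h]; exact letter_imageLength_add_one n

lemma imageLength_strictMono : StrictMono imageLength :=
  strictMono_nat_of_lt_succ fun n => by rw [imageLength_succ]; cases letter n <;> simp [sub]

lemma imageLength_succ_le (n : ℕ) : imageLength (n + 1) ≤ imageLength n + 2 := by
  rw [imageLength_succ]; cases letter n <;> simp [sub]

lemma exists_eq_imageLength (i : ℕ) :
    ∃ n, i = imageLength n ∨ i = imageLength n + 1 ∧ i + 1 = imageLength (n + 1) := by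
  obtain ⟨n, hn, hn'⟩ := exists_mem_Ico_of_strictMono imageLength_strictMono (Nat.zero_le i)
  have := imageLength_succ_le n
  exact ⟨n, by omega⟩

lemma letter_eq_a_iff {i : ℕ} : letter i = .a ↔ ∃ n, i = imageLength n := by
  refine ⟨fun h => ?_, by rintro ⟨n, rfl⟩; exact letter_imageLength n⟩
  obtain ⟨n, hn | ⟨hn, hn'⟩⟩ := exists_eq_imageLength i
  · exact ⟨n, hn⟩
  · have hc : letter n = .c :=
      rotate_injective (by rw [← letter_imageLength_add_one, ← hn, h, rotate])
    have := imageLength_succ_of_eq_c hc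
    omega

lemma letter_succ_of_ne_a {i : ℕ} (h : letter i ≠ .a) : letter (i + 1) = .a := by
  obtain ⟨n, hn | ⟨-, hn⟩⟩ := exists_eq_imageLength i
  · exact absurd (hn ▸ letter_imageLength n) h
  · exact hn ▸ letter_imageLength (n + 1)

lemma eq_a_of_letter_succ_ne_a {i : ℕ} (h : letter (i + 1) ≠ .a) : letter i = .a :=
  not_not.1 (mt letter_succ_of_ne_a h)

lemma imageLength_add_two_ge (n : ℕ) : imageLength n + 3 ≤ imageLength (n + 2) := by
  have h₀ : imageLength n < imageLength (n + 1) := imageLength_strictMono n.lt_add_one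
  have h₁ : imageLength (n + 1) < imageLength (n + 2) :=
    imageLength_strictMono (n + 1).lt_add_one
  by_cases hn : letter n = .c
  · have ha : letter (n + 1) = .a := letter_succ_of_ne_a (by simp [hn])
    have : imageLength (n + 2) = imageLength (n + 1) + 2 := imageLength_succ_of_ne_c (by simp [ha])
    omega
  · have := imageLength_succ_of_ne_c hn
    omega

lemma letter_initial : letter 0 = .a ∧ letter 1 = .b ∧ letter 2 = .a ∧ letter 3 = .c ∧
    letter 4 = .a ∧ letter 5 = .b ∧ letter 6 = .a := by decide

/-! ### Images of repeated factors -/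

section Images

variable {p q n : ℕ}

lemma SameFactor.imageLength_add (h : SameFactor letter p q n) :
    imageLength (p + n) + imageLength q = imageLength (q + n) + imageLength p := by
  induction n with
  | zero => exact Nat.add_comm _ _
  | succ n ih =>
    obtain ⟨hn, hlast⟩ := sameFactor_succ.1 h
    have := ih hn
    rw [← add_assoc p, ← add_assoc q, imageLength_succ, imageLength_succ, hlast]
    omega

lemma sameFactor_image_of_letter_eq (h : letter p = letter q) :
    SameFactor letter (imageLength p) (imageLength q) ((sub (letter p)).length + 1) := by
  refine sameFactor_succ.2 ⟨fun i hi => ?_, ?_⟩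
  · rw [letter_imageLength_add hi, letter_imageLength_add (h ▸ hi)]
    simp only [h]
  · rw [← imageLength_succ, h, ← imageLength_succ, letter_imageLength, letter_imageLength]

/-- The extra letter is the `a` that begins the image of the next letter; it makes the factor of
length `n` readable from its image. -/
theorem sameFactor_image_iff :
    SameFactor letter (imageLength p) (imageLength q) (imageLength (p + n) - imageLength p + 1) ↔
      SameFactor letter p q n := by
  induction n with
  | zero => simp [letter_imageLength, SameFactor]
  | succ n ih =>
    have hp := imageLength_strictMono.monotone (Nat.le_add_right p n)
    have hlt := imageLength_strictMono (p + n).lt_add_one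
    constructor
    · intro h
      have hn := ih.1 (h.mono (by rw [← add_assoc]; omega))
      have hadd := hn.imageLength_add
      have hlast := h (imageLength (p + n) - imageLength p + 1) (by rw [← add_assoc]; omega)
      rw [show imageLength p + (imageLength (p + n) - imageLength p + 1) = imageLength (p + n) + 1
          by omega,
        show imageLength q + (imageLength (p + n) - imageLength p + 1) = imageLength (q + n) + 1
          by omega, letter_imageLength_add_one, letter_imageLength_add_one] at hlast
      exact sameFactor_succ.2 ⟨hn, rotate_injective hlast⟩
    · intro h
      obtain ⟨hn, hlast⟩ := sameFactor_succ.1 h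
      have hadd := hn.imageLength_add
      have hblock := sameFactor_image_of_letter_eq hlast
      rw [← add_assoc, imageLength_succ, Nat.sub_add_comm hp, add_assoc]
      refine ((ih.2 hn).mono (Nat.le_succ _)).append ?_
      rwa [Nat.add_sub_cancel' hp, show imageLength q + (imageLength (p + n) - imageLength p) =
        imageLength (q + n) by omega]

lemma SameFactor.image (h : SameFactor letter p 0 n) :
    SameFactor letter (imageLength p) 0 (imageLength n + 1) := by
  have hlen := h.imageLength_add
  rw [imageLength_zero, zero_add] at hlen
  have himage := sameFactor_image_iff.2 h
  rwa [imageLength_zero, show imageLength (p + n) - imageLength p = imageLength n by omega]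
    at himage

lemma SameFactor.iterate_image (h : SameFactor letter p 0 n) (M : ℕ) :
    SameFactor letter (imageLength^[M] p) 0 (imageLength^[M] n) ∧
      imageLength^[M] (p + n) = imageLength^[M] p + imageLength^[M] n := by
  induction M with
  | zero => exact ⟨h, rfl⟩
  | succ M ih =>
    simp only [Function.iterate_succ_apply']
    have := ih.1.imageLength_add
    rw [imageLength_zero, zero_add] at this
    exact ⟨ih.1.image.mono (Nat.le_succ _), by rw [ih.2]; omega⟩

end Images

lemma iterate_imageLength_strictMono (M : ℕ) : StrictMono imageLength^[M] :=
  imageLength_strictMono.iterate M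

lemma iterate_imageLength_zero (M : ℕ) : imageLength^[M] 0 = 0 :=
  Function.iterate_fixed imageLength_zero M

lemma iterate_imageLength_t (M m : ℕ) : imageLength^[M] (t m) = t (M + m) := by
  induction M with
  | zero => rw [zero_add]; rfl
  | succ M ih => rw [Function.iterate_succ_apply', ih, ← t_succ, add_right_comm]

lemma iterate_imageLength_one (M : ℕ) : imageLength^[M] 1 = t M := iterate_imageLength_t M 0

lemma iterate_imageLength_succ_of_eq_a (M : ℕ) {n : ℕ} (h : letter n = .a) :
    imageLength^[M] (n + 1) = imageLength^[M] n + t M := by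
  rw [← iterate_imageLength_one]
  exact ((sameFactor_one.2 (h.trans (letter_imageLength 0).symm)).iterate_image M).2

/-! ### The common prefix of the images -/

/-- The numbers `0, 1, 3, 7, 14, …`: the length of the prefix that begins each image `σ^M(l) …` of
a letter followed by the images of its successors, see `sameFactor_iterate_imageLength`. -/
def lcpLength : ℕ → ℕ
  | 0 => 0
  | M + 1 => imageLength (lcpLength M) + 1

theorem sameFactor_iterate_imageLength (M s : ℕ) :
    SameFactor letter (imageLength^[M] s) 0 (lcpLength M) := by
  induction M with
  | zero => exact fun i hi => absurd hi (Nat.not_lt_zero i)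
  | succ M ih => rw [Function.iterate_succ_apply']; exact ih.image

lemma sameFactor_t (M : ℕ) : SameFactor letter (t M) 0 (lcpLength M) :=
  iterate_imageLength_one M ▸ sameFactor_iterate_imageLength M 1

lemma lcpLength_succ (M : ℕ) : lcpLength (M + 1) = lcpLength M + t M := by
  induction M with
  | zero => rfl
  | succ M ih =>
    have h := (sameFactor_t M).imageLength_add
    rw [add_comm (t M), ← ih, ← t_succ, zero_add, imageLength_zero] at h
    rw [lcpLength, ← add_zero (imageLength _), h, lcpLength]
    omega

lemma two_mul_lcpLength (M : ℕ) : 2 * lcpLength (M + 1) + 3 = t (M + 2) + t M := by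
  induction M with
  | zero => rfl
  | succ M ih => rw [lcpLength_succ (M + 1), t_add_three]; omega

lemma lcpLength_add_three (M : ℕ) : lcpLength (M + 3) = lcpLength M + t (M + 3) := by
  simp only [lcpLength_succ, t_add_three]; omega

lemma lcpLength_strictMono : StrictMono lcpLength :=
  strictMono_nat_of_lt_succ fun n => by have := t_pos n; rw [lcpLength_succ]; omega

lemma lcpLength_lt_t_succ (M : ℕ) : lcpLength M < t (M + 1) := by
  match M with
  | 0 => decide
  | M + 1 =>
    have := two_mul_lcpLength M
    have : t M < t (M + 2) := t_strictMono (by omega)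
    change lcpLength (M + 1) < t (M + 2)
    omega

lemma t_le_lcpLength_add_one (M : ℕ) : t M ≤ lcpLength M + 1 := by
  induction M using Nat.strong_induction_on with
  | _ M ih =>
    match M with
    | 0 | 1 | 2 => decide
    | M + 3 => have := lcpLength_add_three M; omega

lemma k_add_four (r : ℕ) : k (r + 4) = lcpLength r + 2 := by
  induction r using Nat.strong_induction_on with
  | _ r ih =>
    match r with
    | 0 | 1 | 2 => rfl
    | r + 3 =>
      rw [k, ih r (by omega), ih (r + 1) (by omega), ih (r + 2) (by omega)]
      have := two_mul_lcpLength r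
      simp only [lcpLength_succ] at this ⊢
      omega

/-! ### Repetitions -/

section Repetitions

variable {s l q : ℕ}

/-- The repetition of period `l` on the positions `s, …, s + l + q - 1` lies in an image `σ^M(x)`,
of length `l`, of the letter `x` at a position `s₀`, followed by the common prefix of all images
under `σ^M`. -/
def IsGenerated (s l q : ℕ) : Prop :=
  ∃ M s₀, imageLength^[M] (s₀ + 1) = imageLength^[M] s₀ + l ∧
    imageLength^[M] s₀ ≤ s ∧ s + q ≤ imageLength^[M] s₀ + lcpLength M

lemma sameFactor_of_iterate {M s₀ : ℕ} (hl : imageLength^[M] (s₀ + 1) = imageLength^[M] s₀ + l)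
    (hs : imageLength^[M] s₀ ≤ s) (hq : s + q ≤ imageLength^[M] s₀ + lcpLength M) :
    SameFactor letter s (s + l) q := by
  obtain ⟨d, rfl⟩ := Nat.exists_eq_add_of_le hs
  rw [add_right_comm, ← hl]
  exact ((sameFactor_iterate_imageLength M s₀).trans
    (sameFactor_iterate_imageLength M (s₀ + 1)).symm).drop (by omega)

lemma IsGenerated.mono {s' q' : ℕ} (h : IsGenerated s l q) (hs : s ≤ s') (hq : s' + q' ≤ s + q) :
    IsGenerated s' l q' :=
  let ⟨M, s₀, hl, hs₀, hq₀⟩ := h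
  ⟨M, s₀, hl, hs₀.trans hs, hq.trans hq₀⟩

lemma IsGenerated.image (h : IsGenerated s l q) :
    IsGenerated (imageLength s) (imageLength (s + l) - imageLength s)
      (imageLength (s + q) - imageLength s + 1) := by
  obtain ⟨M, s₀, hl, hs, hq⟩ := h
  have hmono := imageLength_strictMono.monotone
  have hprefix := (sameFactor_iterate_imageLength M s₀).imageLength_add
  have hshift := (sameFactor_of_iterate (q := s - imageLength^[M] s₀) hl le_rfl
    (by omega)).imageLength_add
  rw [Nat.add_sub_cancel' hs, show imageLength^[M] s₀ + l + (s - imageLength^[M] s₀) = s + l by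
    omega, ← hl] at hshift
  have hs' := hmono hs
  have hq' := hmono hq
  have hsl := hmono (Nat.le_add_right s l)
  have hsq := hmono (Nat.le_add_right s q)
  rw [imageLength_zero, zero_add] at hprefix
  refine ⟨M + 1, s₀, ?_, ?_, ?_⟩ <;> simp only [Function.iterate_succ_apply', lcpLength] <;> omega

lemma letter_eq_a_of_eq_succ {i : ℕ} (h : letter i = letter (i + 1)) : letter i = .a := by
  by_contra hne
  exact hne (h.trans (letter_succ_of_ne_a hne))

lemma not_sameFactor_succ_two : ¬ SameFactor letter s (s + 1) 2 := by
  intro h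
  have h₀ : letter s = letter (s + 1) := h 0 (by omega)
  have h₁ : letter (s + 1) = letter (s + 1 + 1) := h 1 (by omega)
  have ha := letter_eq_a_of_eq_succ h₀
  obtain ⟨n, rfl⟩ := letter_eq_a_iff.1 ha
  have hc : letter n = .c :=
    rotate_injective (by rw [← letter_imageLength_add_one, ← h₀, ha, rotate])
  have hsucc : letter (n + 1) = .a := letter_succ_of_ne_a (by simp [hc])
  rw [← h₀, ha, ← imageLength_succ_of_eq_c hc, letter_imageLength_add_one, hsucc] at h₁
  exact absurd h₁ (by decide)

lemma isGenerated_one (h : SameFactor letter s (s + 1) q) : IsGenerated s 1 q := by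
  have hq : q < 2 := by
    by_contra hq
    exact not_sameFactor_succ_two (h.mono (not_lt.1 hq))
  interval_cases q
  · exact ⟨0, s, rfl, le_rfl, le_rfl⟩
  · have h₀ : letter s = letter (s + 1) := sameFactor_one.1 h
    have ha := letter_eq_a_of_eq_succ h₀
    obtain ⟨n, rfl⟩ := letter_eq_a_iff.1 ha
    have hc : letter n = .c :=
      rotate_injective (by rw [← letter_imageLength_add_one, ← h₀, ha, rotate])
    exact ⟨1, n, imageLength_succ_of_eq_c hc, le_rfl, le_rfl⟩

lemma SameFactor.exists_extend_left (h : SameFactor letter s (s + l) q) (hq : 0 < q) :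
    ∃ s' q', s' ≤ s ∧ s' + q' = s + q ∧ 0 < q' ∧ SameFactor letter s' (s' + l) q' ∧
      letter s' = .a := by
  by_cases hs : letter s = .a
  · exact ⟨s, q, le_rfl, rfl, hq, h, hs⟩
  match s with
  | 0 => exact absurd (letter_imageLength 0) hs
  | s + 1 =>
    rw [add_right_comm] at h
    have ha := eq_a_of_letter_succ_ne_a hs
    have ha' : letter (s + l) = .a := eq_a_of_letter_succ_ne_a (h.head hq ▸ hs)
    exact ⟨s, q + 1, by omega, by omega, q.succ_pos,
      sameFactor_succ'.2 ⟨ha.trans ha'.symm, h⟩, ha⟩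

lemma SameFactor.exists_extend_right (h : SameFactor letter s (s + l) q) (hq : 0 < q) :
    ∃ r, q ≤ r + 1 ∧ SameFactor letter s (s + l) (r + 1) ∧ letter (s + r) = .a := by
  obtain ⟨r, rfl⟩ := Nat.exists_eq_add_of_lt hq
  rw [zero_add] at h ⊢
  by_cases hr : letter (s + r) = .a
  · exact ⟨r, le_rfl, h, hr⟩
  · have ha : letter (s + (r + 1)) = .a := letter_succ_of_ne_a hr
    have ha' : letter (s + l + (r + 1)) = .a :=
      letter_succ_of_ne_a (i := s + l + r) (h r r.lt_add_one ▸ hr)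
    exact ⟨r + 1, by omega, sameFactor_succ.2 ⟨h, ha.trans ha'.symm⟩, ha⟩

/-- Extended so that it begins and ends with `a`, a repetition is the image of a shorter one. -/
lemma SameFactor.exists_preimage (h : SameFactor letter s (s + l) q) (hl : 1 < l)
    (hq : l ≤ q + 1) :
    ∃ s' l' q', SameFactor letter s' (s' + l') q' ∧ 0 < l' ∧ l' < l ∧ l' ≤ q' + 1 ∧
      imageLength s' ≤ s ∧ s + q ≤ imageLength (s' + q') + 1 ∧
      imageLength (s' + l') - imageLength s' = l := by
  obtain ⟨s₁, q₁, hs₁, hq₁, hpos, h₁, ha⟩ := h.exists_extend_left (by omega)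
  obtain ⟨r, hr, h₂, hb⟩ := h₁.exists_extend_right hpos
  obtain ⟨s', rfl⟩ := letter_eq_a_iff.1 ha
  obtain ⟨p', hp'⟩ := letter_eq_a_iff.1 ((h₂.head (Nat.succ_pos r)).symm.trans ha)
  obtain ⟨e', he'⟩ := letter_eq_a_iff.1 hb
  obtain ⟨l', rfl⟩ := Nat.exists_eq_add_of_lt
    (imageLength_strictMono.lt_iff_lt.1 (show imageLength s' < imageLength p' by omega))
  obtain ⟨q', rfl⟩ := Nat.exists_eq_add_of_le
    (imageLength_strictMono.le_iff_le.1 (show imageLength s' ≤ imageLength e' by omega))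
  refine ⟨s', l' + 1, q', ?_, l'.succ_pos, ?_, ?_, hs₁, by omega, by rw [← add_assoc]; omega⟩
  · rw [← add_assoc, ← sameFactor_image_iff, ← hp', ← he', Nat.add_sub_cancel_left]
    exact h₂
  · match l' with
    | 0 => omega
    | l' + 1 =>
      have := imageLength_add_two_ge s'
      have := imageLength_strictMono.add_le_nat l' (s' + 2)
      rw [show l' + (s' + 2) = s' + (l' + 1) + 1 by omega] at this
      omega
  · by_contra hlt
    have := imageLength_add_two_ge (s' + q')
    have := imageLength_strictMono.monotone (show s' + q' + 2 ≤ s' + l' + 1 by omega)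
    omega

theorem SameFactor.isGenerated (h : SameFactor letter s (s + l) q) (hl : 0 < l)
    (hq : l ≤ q + 1) : IsGenerated s l q := by
  induction l using Nat.strong_induction_on generalizing s q with
  | _ l ih =>
    obtain rfl | hl1 := (Nat.succ_le_of_lt hl).eq_or_lt
    · exact isGenerated_one h
    · obtain ⟨s', l', q', h', hl', hlt, hq', hs, he, rfl⟩ := h.exists_preimage hl1 hq
      have := imageLength_strictMono.monotone (Nat.le_add_right s' q')
      exact (ih l' hlt h' hl' hq').image.mono hs (by omega)

lemma t_succ_le_two_mul (M : ℕ) : t (M + 1) ≤ 2 * t M := by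
  rw [t_succ]
  generalize t M = n
  induction n with
  | zero => rfl
  | succ n ih => exact (imageLength_succ_le n).trans (by omega)

lemma t_le_of_iterate_succ {M s₀ : ℕ}
    (h : imageLength^[M + 1] (s₀ + 1) = imageLength^[M + 1] s₀ + l) : t M ≤ l := by
  have ha := iterate_imageLength_succ_of_eq_a M (letter_imageLength s₀)
  have hle := (iterate_imageLength_strictMono M).monotone
    (show imageLength s₀ + 1 ≤ imageLength (s₀ + 1) from imageLength_strictMono s₀.lt_add_one)
  simp only [Function.iterate_succ_apply] at h
  omega

theorem not_sameFactor_three_mul (hl : 0 < l) : ¬ SameFactor letter s (s + l) (3 * l) := by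
  intro h
  obtain ⟨M, s₀, hper, hs, hq⟩ := h.isGenerated hl (by omega)
  match M with
  | 0 => simp only [lcpLength] at hq; omega
  | M + 1 =>
    have := t_le_of_iterate_succ hper
    have := t_succ_le_two_mul M
    have := lcpLength_lt_t_succ M
    rw [lcpLength_succ] at hq
    omega

lemma SameFactor.not_inner_occurrence_letter {j : ℕ} (h : SameFactor letter s (s + l) l)
    (hj : 0 < j) (hjl : j < l) : ¬ SameFactor letter s (s + j) l :=
  h.not_inner_occurrence (fun _ hl => not_sameFactor_three_mul hl) hj hjl

end Repetitions

/-! ### Occurrences and squares -/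

section Occurrences

variable {w w' : List Letter} {p p' n n' s e l : ℕ}

lemma factor_eq_factorAt (s l : ℕ) : factor (s + 1) (s + l) = factorAt s l := by
  rw [factor, factorAt, show s + l + 1 - (s + 1) = l by omega, List.range'_eq_map_range,
    List.map_map]
  exact List.map_congr_left fun i _ => congrArg trib (add_right_comm s 1 i)

lemma endsAt_iff : EndsAt w n ↔ ∃ s, s + w.length = n ∧ factorAt s w.length = w := by
  constructor
  · rintro ⟨hle, hw⟩
    obtain ⟨s, rfl⟩ := Nat.exists_eq_add_of_le' hle
    exact ⟨s, rfl, by rwa [Nat.add_sub_cancel, factor_eq_factorAt] at hw⟩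
  · rintro ⟨s, rfl, hw⟩
    exact ⟨Nat.le_add_left _ _, by rwa [Nat.add_sub_cancel, factor_eq_factorAt]⟩

lemma endsAt_factorAt_iff :
    EndsAt (factorAt s l) n ↔ ∃ s', s' + l = n ∧ SameFactor letter s' s l := by
  rw [endsAt_iff, length_factorAt]
  simp only [factorAt_eq_iff]

lemma finite_endsAt (w : List Letter) (n : ℕ) : {i : ℕ | i ≤ n ∧ EndsAt w i}.Finite :=
  (Set.finite_Iic n).subset fun _ h => h.1

lemma IsOcc.le (h : IsOcc w p n) (h' : IsOcc w p n') : n ≤ n' := by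
  by_contra! hlt
  have hss : {i | i ≤ n' ∧ EndsAt w i} ⊂ {i | i ≤ n ∧ EndsAt w i} :=
    ⟨fun i hi => ⟨hi.1.trans hlt.le, hi.2⟩, fun hsub => hlt.not_ge (hsub ⟨le_rfl, h.1⟩).1⟩
  exact (Set.ncard_lt_ncard hss (finite_endsAt w n)).ne (h'.2.trans h.2.symm)

lemma IsOcc.unique (h : IsOcc w p n) (h' : IsOcc w p n') : n = n' :=
  le_antisymm (h.le h') (h'.le h)

lemma IsOcc.succ (h : IsOcc w p e) (hen : e < n) (hn : EndsAt w n)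
    (hgap : ∀ i, e < i → i < n → ¬ EndsAt w i) : IsOcc w (p + 1) n := by
  have hinsert : {i | i ≤ n ∧ EndsAt w i} = insert n {i | i ≤ e ∧ EndsAt w i} := by
    ext i
    constructor
    · rintro ⟨hin, hi⟩
      obtain rfl | hlt := hin.eq_or_lt
      · exact Or.inl rfl
      · exact Or.inr ⟨not_lt.1 fun hei => hgap i hei hlt hi, hi⟩
    · rintro (rfl | ⟨hie, hi⟩)
      · exact ⟨le_rfl, hn⟩
      · exact ⟨hie.trans hen.le, hi⟩
  refine ⟨hn, ?_⟩
  rw [hinsert, Set.ncard_insert_of_notMem (fun h => hen.not_ge h.1) (finite_endsAt w e), h.2]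

lemma pos_one_of_isLeast (h : IsLeast {i | EndsAt w i} n) : pos w 1 = n := by
  have hocc : IsOcc w 1 n := by
    refine ⟨h.1, Set.ncard_eq_one.2 ⟨n, ?_⟩⟩
    ext i
    exact ⟨fun hi => le_antisymm hi.1 (h.2 hi.2), by rintro rfl; exact ⟨le_rfl, h.1⟩⟩
  exact le_antisymm (Nat.sInf_le hocc) (le_csInf ⟨n, hocc⟩ fun i hi => h.2 hi.1)

/-- The lengths of the roots of the squares that end at position `n`, in the numbering from `1`. -/
def periods (n : ℕ) : Set ℕ :=
  {l | 0 < l ∧ ∃ s, s + 2 * l = n ∧ SameFactor letter s (s + l) l}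

lemma finite_periods (n : ℕ) : (periods n).Finite :=
  (Set.finite_Iic n).subset fun l ⟨_, s, hs, _⟩ => by simp only [Set.mem_Iic]; omega

lemma SquareAt.length_mem_periods (h : SquareAt w p n) : w.length ∈ periods n := by
  obtain ⟨hw, e, h₁, h₂, rfl⟩ := h
  obtain ⟨s, rfl, hs⟩ := endsAt_iff.1 h₁.1
  obtain ⟨s', hs', hs''⟩ := endsAt_iff.1 h₂.1
  obtain rfl := Nat.add_right_cancel hs'
  exact ⟨List.length_pos_iff.2 hw, s, by omega, factorAt_eq_iff.1 (hs.trans hs''.symm)⟩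

lemma exists_squareAt (h : l ∈ periods n) : ∃ w p, w.length = l ∧ SquareAt w p n := by
  obtain ⟨hl, s, rfl, hs⟩ := h
  have h₁ : EndsAt (factorAt s l) (s + l) := endsAt_factorAt_iff.2 ⟨s, rfl, fun _ _ => rfl⟩
  have h₂ : EndsAt (factorAt s l) (s + l + l) := endsAt_factorAt_iff.2 ⟨s + l, rfl, hs.symm⟩
  refine ⟨factorAt s l, _, length_factorAt s l, ?_, s + l, ⟨h₁, rfl⟩, ?_, ?_⟩
  · exact List.length_pos_iff.1 (by rwa [length_factorAt])
  · rw [length_factorAt]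
    refine IsOcc.succ ⟨h₁, rfl⟩ (by omega) h₂ fun i hi hi' hocc => ?_
    obtain ⟨s', rfl, hs'⟩ := endsAt_factorAt_iff.1 hocc
    obtain ⟨j, rfl⟩ := Nat.exists_eq_add_of_le (show s ≤ s' by omega)
    exact hs.not_inner_occurrence_letter (j := j) (by omega) (by omega) hs'.symm
  · rw [length_factorAt]; omega

lemma SquareAt.eq_of_length_eq (h : SquareAt w p n) (h' : SquareAt w' p' n)
    (hlen : w.length = w'.length) : (w, p) = (w', p') := by
  obtain ⟨-, e, h₁, -, rfl⟩ := h
  obtain ⟨-, e', h₁', -, he⟩ := h'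
  obtain rfl : e' = e := by omega
  obtain ⟨s, hs, hw⟩ := endsAt_iff.1 h₁.1
  obtain ⟨s', hs', hw'⟩ := endsAt_iff.1 h₁'.1
  obtain rfl : s' = s := by omega
  obtain rfl : w' = w := by rw [← hw, ← hw', hlen]
  rw [← h₁.2, ← h₁'.2]

lemma image_length_squareAt (n : ℕ) :
    (fun x : List Letter × ℕ => x.1.length) '' {x | SquareAt x.1 x.2 n} = periods n := by
  ext l
  constructor
  · rintro ⟨x, hx, rfl⟩
    exact hx.length_mem_periods
  · intro hl
    obtain ⟨w, p, hw, h⟩ := exists_squareAt hl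
    exact ⟨(w, p), h, hw⟩

lemma injOn_length_squareAt (n : ℕ) :
    Set.InjOn (fun x : List Letter × ℕ => x.1.length) {x | SquareAt x.1 x.2 n} :=
  fun _ hx _ hy h => SquareAt.eq_of_length_eq hx hy h

lemma finite_squareAt (n : ℕ) : {x : List Letter × ℕ | SquareAt x.1 x.2 n}.Finite :=
  Set.Finite.of_finite_image (by rw [image_length_squareAt]; exact finite_periods n)
    (injOn_length_squareAt n)

theorem b_eq_ncard_periods (n : ℕ) : b n = (periods n).ncard := by
  rw [← image_length_squareAt, (injOn_length_squareAt n).ncard_image, b]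

lemma SquareAt.pos_of_end (h : SquareAt w p n) : 0 < n := by
  obtain ⟨hl, s, hs, -⟩ := h.length_mem_periods
  omega

theorem B_eq_sum (n : ℕ) : B n = ∑ i ∈ Finset.Icc 1 n, b i := by
  have hunion : {x : List Letter × ℕ | ∃ e ≤ n, SquareAt x.1 x.2 e} =
      ⋃ e ∈ Set.Icc 1 n, {x | SquareAt x.1 x.2 e} := by
    ext x
    simp only [Set.mem_iUnion₂, Set.mem_ofPred_eq, Set.mem_Icc, exists_prop]
    exact exists_congr fun e =>
      ⟨fun h => ⟨⟨h.2.pos_of_end, h.1⟩, h.2⟩, fun h => ⟨h.1.2, h.2⟩⟩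
  have hdisj : (Set.Icc 1 n).PairwiseDisjoint
      fun e => {x : List Letter × ℕ | SquareAt x.1 x.2 e} := by
    refine fun e _ e' _ hne => Set.disjoint_left.2 fun x hx hx' => hne ?_
    obtain ⟨-, f, h, -, rfl⟩ := hx
    obtain ⟨-, f', h', -, rfl⟩ := hx'
    rw [h.unique h']
  rw [B, hunion, (Set.finite_Icc 1 n).ncard_biUnion (fun e _ => finite_squareAt e) hdisj,
    ← Finset.coe_Icc, finsum_mem_coe_finset]
  rfl

end Occurrences

/-! ### Squares ending in a block -/

section Crossing

variable {r m n l : ℕ} {j : Idx}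

lemma iterate_imageLength_lcpLength (M j : ℕ) :
    imageLength^[M] (lcpLength j) + lcpLength M = lcpLength (M + j) := by
  induction M generalizing j with
  | zero => rw [zero_add]; rfl
  | succ M ih =>
    have h := ih (j + 1)
    rw [lcpLength, iterate_imageLength_succ_of_eq_a M (letter_imageLength _)] at h
    rw [Function.iterate_succ_apply, lcpLength_succ M, add_right_comm M 1 j, add_assoc M j 1, ← h]
    omega

lemma lcpLength_add_one_eq_t_iff {j : ℕ} : lcpLength j + 1 = t j ↔ j ≤ 2 := by
  match j with
  | 0 | 1 | 2 => decide
  | j + 3 =>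
    rw [lcpLength_add_three]
    omega

lemma generator_level_le {M s : ℕ} (hper : imageLength^[M] (s + 1) = imageLength^[M] s + l)
    (hs : imageLength^[M] s < t m) (hl : 2 * l ≤ t m + lcpLength m) : M ≤ m := by
  by_contra! hlt
  have ht : t (m + 1) ≤ t M := t_strictMono.monotone hlt
  have hm := lcpLength_lt_t_succ m
  have htm : t m < t (m + 1) := t_strictMono m.lt_add_one
  obtain rfl | hpos := s.eq_zero_or_pos
  · rw [zero_add, iterate_imageLength_one, iterate_imageLength_zero] at hper
    omega
  · have := (iterate_imageLength_strictMono M).monotone (show 1 ≤ s from hpos)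
    rw [iterate_imageLength_one] at this
    omega

/-- A square that ends here and begins in the prefix of length `t m` is generated by the image under
`σ^M` of the letter at position `s₀ = lcpLength j`, the last one of the prefix of length `t j`,
where `M + j = m`. -/
theorem mem_periods_crossing_iff (hn : lcpLength m < n) (hn' : n ≤ t m + lcpLength m) :
    l ∈ periods n ∧ n < t m + 2 * l ↔
      (∃ M j, M + j = m ∧ j ≤ 2 ∧ l + lcpLength m = t m + lcpLength M ∧ n ≤ t m + lcpLength M) ∧
        t m + l ≤ n ∧ n < t m + 2 * l := by
  constructor
  · rintro ⟨⟨hl, s, rfl, hs⟩, hst⟩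
    obtain ⟨M, s₀, hper, hle, hend⟩ := hs.isGenerated hl (by omega)
    obtain ⟨j, rfl⟩ := Nat.exists_eq_add_of_le
      (generator_level_le (m := m) hper (by omega) (by omega))
    have hmono := (iterate_imageLength_strictMono M).monotone
    have hlcp := iterate_imageLength_lcpLength M j
    have ht := iterate_imageLength_t M j
    have hs₀t : s₀ < t j := (iterate_imageLength_strictMono M).lt_iff_lt.1 (by omega)
    have hs₀lcp : lcpLength j < s₀ + 1 := by
      by_contra! hge
      have := hmono hge
      omega
    have htj := t_le_lcpLength_add_one j
    obtain rfl : s₀ = lcpLength j := by omega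
    obtain htj' : lcpLength j + 1 = t j := by omega
    rw [htj'] at hper
    exact ⟨⟨M, j, rfl, lcpLength_add_one_eq_t_iff.1 htj', by omega, by omega⟩, by omega, hst⟩
  · rintro ⟨⟨M, j, rfl, hj, hl, hn⟩, hlo, hhi⟩
    have hlcp := iterate_imageLength_lcpLength M j
    have ht := iterate_imageLength_t M j
    obtain ⟨s, rfl⟩ := Nat.exists_eq_add_of_le' (show 2 * l ≤ n by omega)
    have hper : imageLength^[M] (lcpLength j + 1) = imageLength^[M] (lcpLength j) + l := by
      rw [lcpLength_add_one_eq_t_iff.2 hj]; omega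
    exact ⟨⟨by omega, s, rfl, sameFactor_of_iterate hper (by omega) (by omega)⟩, hhi⟩

lemma mem_periods_add_t_iff (hn : n ≤ lcpLength m) :
    l ∈ periods (t m + n) ∧ ¬ n < 2 * l ↔ l ∈ periods n := by
  constructor
  · rintro ⟨⟨hl, s, hs, h⟩, hln⟩
    obtain ⟨s, rfl⟩ := Nat.exists_eq_add_of_le (show t m ≤ s by omega)
    refine ⟨hl, s, by omega, ?_⟩
    have h₀ := (sameFactor_t m).drop (m := s) (r := l) (by omega)
    have h₁ := (sameFactor_t m).drop (m := s + l) (r := l) (by omega)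
    rw [zero_add] at h₀ h₁
    exact h₀.symm.trans (h.trans (by rwa [add_assoc]))
  · rintro ⟨hl, s, rfl, h⟩
    refine ⟨⟨hl, t m + s, by omega, ?_⟩, by omega⟩
    have h₀ := (sameFactor_t m).drop (m := s) (r := l) (by omega)
    have h₁ := (sameFactor_t m).drop (m := s + l) (r := l) (by omega)
    rw [zero_add] at h₀ h₁
    exact h₀.trans (h.trans (by rw [add_assoc]; exact h₁.symm))

lemma b_eq_add_ite {c : ℕ} {p : Prop} [Decidable p] (hn : t m ≤ n) (hn' : n ≤ t m + lcpLength m)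
    (h : ∀ l, l ∈ periods n ∧ n < t m + 2 * l ↔ l = c ∧ p) :
    b n = b (n - t m) + if p then 1 else 0 := by
  obtain ⟨n, rfl⟩ := Nat.exists_eq_add_of_le hn
  have hsplit : periods (t m + n) = periods n ∪ {l | l = c ∧ p} := by
    ext l
    rw [Set.mem_union, Set.mem_ofPred_eq, ← h,
      ← mem_periods_add_t_iff (Nat.add_le_add_iff_left.1 hn'), Nat.add_lt_add_iff_left]
    tauto
  have hdisj : Disjoint (periods n) {l | l = c ∧ p} := by
    refine Set.disjoint_left.2 fun l hl hl' => ?_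
    obtain ⟨-, s, hs, -⟩ := hl
    have := ((h l).2 hl').2
    omega
  have hcard : {l | l = c ∧ p}.ncard = if p then 1 else 0 := by
    by_cases hp : p <;> simp [hp]
  rw [Nat.add_sub_cancel_left, b_eq_ncard_periods, b_eq_ncard_periods, hsplit,
    Set.ncard_union_eq hdisj (finite_periods n) ((Set.finite_singleton c).subset fun l hl => hl.1),
    hcard]

end Crossing

/-- The number of levels by which the recursive description of the block `j` descends. -/
def depth : Idx → ℕ
  | .one => 1
  | .two => 2
  | .three => 3

/-- The block `j` of level `r + 4` consists of the positions `n` with `lo j r < n ≤ hi j r`. -/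
def lo (j : Idx) (r : ℕ) : ℕ := t (r + 3) + lcpLength (r + 3 - depth j)

/-- The last position of the block `j` of level `r + 4`. -/
def hi (j : Idx) (r : ℕ) : ℕ := t (r + 3) + lcpLength (r + 4 - depth j)

/-- The position in the block `j` of level `r + 4` at which the number of squares that begin in the
prefix `T_{r+3}` changes: `η³`, `η²`, `η¹` for `j = 1, 2, 3`. -/
def cut (j : Idx) (r : ℕ) : ℕ :=
  match j with
  | .one => 2 * t (r + 3)
  | .two => t (r + 3) + t (r + 1) + t r
  | .three => t (r + 3) + 2 * t r

/-- The number of squares that end at the position `n` of the block `j` of level `r + 4` and begin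
in the prefix `T_{r+3}`. -/
def gain (j : Idx) (r n : ℕ) : ℕ :=
  match j with
  | .one | .two => if cut j r ≤ n then 1 else 0
  | .three => if n < cut .three r then 1 else 0

lemma mem_periods_crossing_add_three_iff {l n r : ℕ} (hn : lcpLength (r + 3) < n)
    (hn' : n ≤ t (r + 3) + lcpLength (r + 3)) :
    l ∈ periods n ∧ n < t (r + 3) + 2 * l ↔
      (l = t (r + 3) ∨ l = t (r + 1) + t r ∧ n ≤ t (r + 3) + lcpLength (r + 2) ∨
        l = t r ∧ n ≤ t (r + 3) + lcpLength (r + 1)) ∧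
      t (r + 3) + l ≤ n ∧ n < t (r + 3) + 2 * l := by
  rw [mem_periods_crossing_iff hn hn']
  refine and_congr_left fun _ => ?_
  have := t_add_three r
  simp only [lcpLength_succ] at *
  constructor
  · rintro ⟨M, j, hMj, hj, hl, hn⟩
    obtain rfl | rfl | rfl : M = r + 3 ∨ M = r + 2 ∨ M = r + 1 := by omega
    all_goals simp only [lcpLength_succ, t_add_three] at *; omega
  · rintro (rfl | ⟨rfl, hn⟩ | ⟨rfl, hn⟩)
    · exact ⟨r + 3, 0, rfl, by omega, by simp only [lcpLength_succ], by
        simpa only [lcpLength_succ] using hn'⟩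
    · exact ⟨r + 2, 1, rfl, by omega, by simp only [lcpLength_succ]; omega, by
        simpa only [lcpLength_succ] using hn⟩
    · exact ⟨r + 1, 2, rfl, by omega, by simp only [lcpLength_succ]; omega, by
        simpa only [lcpLength_succ] using hn⟩

theorem b_eq_add_gain {j : Idx} {r n : ℕ} (hlo : lo j r < n) (hhi : n ≤ hi j r) :
    b n = b (n - t (r + 3)) + gain j r n := by
  have := t_le_lcpLength_add_one r
  have := lcpLength_lt_t_succ r
  have : t r < t (r + 1) := t_strictMono r.lt_add_one
  have : t (r + 1) < t (r + 2) := t_strictMono (r + 1).lt_add_one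
  have crossing (l : ℕ) := mem_periods_crossing_add_three_iff (r := r) (n := n) (l := l)
  cases j <;> simp only [lo, hi, depth, gain, cut, Nat.reduceSubDiff, Nat.add_sub_cancel,
    lcpLength_succ] at *
  · refine b_eq_add_ite (c := t (r + 3)) (by omega) (by simp only [lcpLength_succ]; omega)
      fun l => ?_
    rw [crossing l] <;> simp only [t_add_three] at * <;> omega
  · refine b_eq_add_ite (c := t (r + 1) + t r) (by omega) (by simp only [lcpLength_succ]; omega)
      fun l => ?_
    rw [crossing l] <;> simp only [t_add_three] at * <;> omega
  · refine b_eq_add_ite (c := t r) (by omega) (by simp only [lcpLength_succ]; omega)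
      fun l => ?_
    rw [crossing l] <;> simp only [t_add_three] at * <;> omega

/-! ### Kernel words -/

section Kernel

variable {M p n r : ℕ}

lemma SameFactor.of_image (h : SameFactor letter (imageLength p) 0 (imageLength n + 2)) :
    SameFactor letter p 0 (n + 1) := by
  have hn : SameFactor letter 0 p n := by
    rw [← sameFactor_image_iff, zero_add, imageLength_zero, Nat.sub_zero]
    exact h.symm.mono (Nat.le_succ _)
  have hlen : imageLength (p + n) = imageLength p + imageLength n := by
    simpa only [imageLength_zero, zero_add, add_zero, add_comm] using hn.imageLength_add.symm
  refine sameFactor_succ.2 ⟨hn.symm, rotate_injective ?_⟩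
  rw [zero_add, ← letter_imageLength_add_one, ← letter_imageLength_add_one, hlen]
  simpa only [zero_add, add_assoc] using h (imageLength n + 1) (Nat.lt_add_one _)

lemma t_le_of_kernel_occurrence (hp : letter p = letter (t (M + 3) - 1))
    (h : SameFactor letter (p + 1) 0 (lcpLength M + 1)) : t (M + 3) ≤ p + 1 := by
  induction M generalizing p with
  | zero =>
    obtain ⟨_, h₁, _, h₃, _, h₅, h₆⟩ := letter_initial
    have h0 := h.head (Nat.succ_pos _)
    change letter p = letter 6 at hp
    change 7 ≤ p + 1
    by_contra! hlt
    have hlt' : p < 6 := by omega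
    interval_cases p <;> simp_all
  | succ M ih =>
    have ha : letter (p + 1) = .a := (h.head (Nat.succ_pos _)).trans (letter_imageLength 0)
    obtain ⟨p', hp'⟩ := letter_eq_a_iff.1 ha
    have hT : t (M + 1 + 3) = imageLength (t (M + 3)) := t_succ (M + 3)
    have htpos := t_pos (M + 3)
    match p' with
    | 0 => simp [imageLength_zero] at hp'
    | p' + 1 =>
      rw [hT, hp']
      refine imageLength_strictMono.monotone (ih (rotate_injective ?_) (SameFactor.of_image ?_))
      · rw [← letter_imageLength_succ_sub_one, ← letter_imageLength_succ_sub_one, ← hp',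
          Nat.sub_add_cancel htpos, ← hT, ← hp, Nat.add_sub_cancel]
      · rwa [← hp']

lemma kernel_add_four (r : ℕ) :
    kernel (r + 4) = factorAt (t (r + 3) - 1) (lcpLength r + 2) := by
  have hlast : (word (r + 3)).getLastD .a = letter (t (r + 3) - 1) := by
    have hpos : t (r + 3) - 1 + 1 = t (r + 3) := Nat.sub_add_cancel (t_pos _)
    rw [word_eq_factorAt, ← hpos, factorAt_succ]
    simp
  have htail : SameFactor letter (t (r + 3)) 0 (lcpLength r + 1) :=
    (sameFactor_t _).mono (lcpLength_strictMono (by omega))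
  rw [kernel, hlast, k_add_four, word_eq_factorAt, Nat.add_sub_assoc (by omega),
    take_factorAt 0 (lcpLength_lt_t_succ r), factorAt_succ' _ (_ + 1),
    Nat.sub_add_cancel (t_pos _), factorAt_eq_iff.2 htail]

theorem pos_kernel (r : ℕ) : pos (kernel (r + 4)) 1 = lcpLength (r + 3) + 1 := by
  have hpos := t_pos (r + 3)
  have hlen := lcpLength_add_three r
  rw [kernel_add_four]
  refine pos_one_of_isLeast ⟨endsAt_factorAt_iff.2 ⟨_, by omega, fun _ _ => rfl⟩, fun n hn => ?_⟩
  obtain ⟨s, rfl, hs⟩ := endsAt_factorAt_iff.1 hn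
  obtain ⟨hhead, htail⟩ := sameFactor_succ'.1 hs
  rw [Nat.sub_add_cancel hpos] at htail
  have := t_le_of_kernel_occurrence hhead
    (htail.trans ((sameFactor_t _).mono (lcpLength_strictMono (by omega))))
  omega

end Kernel

/-! ### Blocks -/

section Blocks

variable {n r r' : ℕ} {j j' : Idx}

lemma lo_three (r : ℕ) : lo .three r = lcpLength (r + 3) := by
  rw [lcpLength_add_three, Nat.add_comm]; rfl

lemma hi_one (r : ℕ) : hi .one r = lcpLength (r + 4) := by
  rw [lcpLength_succ, Nat.add_comm]; rfl

lemma hi_eq_lo_add (j : Idx) (r : ℕ) : hi j r = lo j r + t (r + 3 - depth j) := by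
  cases j <;> rw [hi, lo, add_assoc, ← lcpLength_succ] <;> rfl

lemma lo_add_depth (j : Idx) (q : ℕ) :
    lo j (q + depth j) = t (q + depth j + 3) + lcpLength (q + 3) := by
  cases j <;> rfl

lemma hi_add_depth (j : Idx) (q : ℕ) :
    hi j (q + depth j) = t (q + depth j + 3) + lcpLength (q + 4) := by
  cases j <;> rfl

lemma lo_lt_hi (j : Idx) (r : ℕ) : lo j r < hi j r := by
  rw [hi_eq_lo_add]
  exact Nat.lt_add_of_pos_right (t_pos _)

lemma lcpLength_le_lo (j : Idx) (r : ℕ) : lcpLength (r + 3) ≤ lo j r := by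
  rw [← lo_three]
  exact Nat.add_le_add_left (lcpLength_strictMono.monotone (by cases j <;> simp [depth])) _

lemma hi_le_lcpLength (j : Idx) (r : ℕ) : hi j r ≤ lcpLength (r + 4) := by
  rw [← hi_one]
  exact Nat.add_le_add_left (lcpLength_strictMono.monotone (by cases j <;> simp [depth])) _

lemma t_le_lo (j : Idx) (r : ℕ) : t (r + 3) ≤ lo j r := Nat.le_add_right _ _

lemma gMin_eq (j : Idx) (r : ℕ) : gMin j (r + 4) 1 = lo j r + 1 := by
  have ht : t (r + 4) = t (r + 3) + t (r + 2) + t (r + 1) := t_add_three (r + 1)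
  cases j
  · change _ + t (r + 3) - t (r + 2) = t (r + 3) + lcpLength (r + 2) + 1
    rw [pos_kernel, lcpLength_succ (r + 2)]; omega
  · change _ + 2 * t (r + 3) - t (r + 4) = t (r + 3) + lcpLength (r + 1) + 1
    simp only [pos_kernel, lcpLength_succ]; omega
  · rw [lo_three]
    exact pos_kernel r

lemma gMax_eq (j : Idx) (r : ℕ) : gMax j (r + 4) 1 = hi j r := by
  have ht : t (r + 4) = t (r + 3) + t (r + 2) + t (r + 1) := t_add_three (r + 1)
  cases j
  · change _ + t (r + 3) - 1 = _
    rw [pos_kernel, hi_one, lcpLength_succ (r + 3)]; omega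
  · change _ + t (r + 3) - t (r + 2) - 1 = t (r + 3) + lcpLength (r + 2)
    rw [pos_kernel, lcpLength_succ (r + 2)]; omega
  · change _ + 2 * t (r + 3) - t (r + 4) - 1 = t (r + 3) + lcpLength (r + 1)
    simp only [pos_kernel, lcpLength_succ]; omega

lemma block_eq (j : Idx) (r : ℕ) :
    block j (r + 4) 1 = List.range' (lo j r + 1) (t (r + 3 - depth j)) := by
  rw [block, gMin_eq, gMax_eq, Nat.add_sub_add_right, hi_eq_lo_add, Nat.add_sub_cancel_left]

lemma length_block (j : Idx) (r : ℕ) : (block j (r + 4) 1).length = t (r + 3 - depth j) := by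
  rw [block_eq, List.length_range']

lemma mem_block_iff : n ∈ block j (r + 4) 1 ↔ lo j r < n ∧ n ≤ hi j r := by
  rw [block_eq, List.mem_range'_1, hi_eq_lo_add]
  omega

lemma lcpLength_lt_of_lo_lt (h : lo j r < n) : lcpLength (r + 3) < n :=
  (lcpLength_le_lo j r).trans_lt h

lemma le_lcpLength_of_le_hi (h : n ≤ hi j r) : n ≤ lcpLength (r + 4) :=
  h.trans (hi_le_lcpLength j r)

lemma lcpLength_values : lcpLength 3 = 7 ∧ lcpLength 4 = 14 ∧ lcpLength 5 = 27 ∧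
    lcpLength 6 = 51 := by
  simp only [lcpLength_succ]
  decide

lemma exists_level (hn : 8 ≤ n) : ∃ r, lcpLength (r + 3) < n ∧ n ≤ lcpLength (r + 4) := by
  obtain ⟨r, hr, hr'⟩ := exists_mem_Ico_of_strictMono (f := fun r => lcpLength (r + 3) + 1)
    (fun _ _ h => Nat.succ_lt_succ (lcpLength_strictMono (Nat.add_lt_add_right h 3)))
    (show lcpLength 3 + 1 ≤ n by rwa [lcpLength_values.1])
  exact ⟨r, hr, Nat.lt_succ_iff.1 hr'⟩

lemma level_unique (h : lcpLength (r + 3) < n) (h' : n ≤ lcpLength (r + 4))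
    (hr : lcpLength (r' + 3) < n) (hr' : n ≤ lcpLength (r' + 4)) : r = r' := by
  have h₁ := lcpLength_strictMono.lt_iff_lt.1 (h.trans_le hr')
  have h₂ := lcpLength_strictMono.lt_iff_lt.1 (hr.trans_le h')
  omega

lemma exists_block (h : lcpLength (r + 3) < n) (h' : n ≤ lcpLength (r + 4)) :
    ∃ j, lo j r < n ∧ n ≤ hi j r := by
  by_cases h₃ : n ≤ hi .three r
  · exact ⟨.three, lo_three r ▸ h, h₃⟩
  · by_cases h₂ : n ≤ hi .two r
    · exact ⟨.two, not_le.1 h₃, h₂⟩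
    · exact ⟨.one, not_le.1 h₂, hi_one r ▸ h'⟩

lemma block_unique (h : lo j r < n) (h' : n ≤ hi j r) (hj : lo j' r < n) (hj' : n ≤ hi j' r) :
    j = j' := by
  have h₁ := lcpLength_strictMono.lt_iff_lt.1 (Nat.add_lt_add_iff_left.1 (h.trans_le hj'))
  have h₂ := lcpLength_strictMono.lt_iff_lt.1 (Nat.add_lt_add_iff_left.1 (hj.trans_le h'))
  cases j <;> cases j' <;> simp only [depth] at * <;> omega

theorem existsUnique_block (hn : 8 ≤ n) :
    ∃! q : Idx × ℕ, 4 ≤ q.2 ∧ n ∈ block q.1 q.2 1 := by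
  obtain ⟨r, hr, hr'⟩ := exists_level hn
  obtain ⟨j, hj, hj'⟩ := exists_block hr hr'
  refine ⟨(j, r + 4), ⟨Nat.le_add_left 4 r, mem_block_iff.2 ⟨hj, hj'⟩⟩, ?_⟩
  rintro ⟨i, m⟩ ⟨hm, hi⟩
  obtain ⟨s, rfl⟩ := Nat.exists_eq_add_of_le' hm
  obtain ⟨hi, hi'⟩ := mem_block_iff.1 hi
  obtain rfl := level_unique hr hr' (lcpLength_lt_of_lo_lt hi) (le_lcpLength_of_le_hi hi')
  rw [block_unique hj hj' hi hi']

lemma lt_level_of_lcpLength_lt {s : ℕ} (hs : lcpLength s < n) (h : n ≤ hi j r) : s < r + 4 :=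
  lcpLength_strictMono.lt_iff_lt.1 (hs.trans_le (le_lcpLength_of_le_hi h))

theorem level_ge {m : ℕ} (hm : 4 ≤ m) (h : n ∈ block j m 1) :
    (52 ≤ n → 7 ≤ m) ∧ (32 ≤ n → j = .two → 6 ≤ m) ∧ (21 ≤ n → j = .one → 5 ≤ m) := by
  obtain ⟨-, h4, h5, h6⟩ := lcpLength_values
  obtain ⟨r, rfl⟩ := Nat.exists_eq_add_of_le' hm
  have hhi := (mem_block_iff.1 h).2
  exact ⟨fun hn => lt_level_of_lcpLength_lt (s := 6) (by omega) hhi,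
    fun hn _ => lt_level_of_lcpLength_lt (s := 5) (by omega) hhi,
    fun hn _ => lt_level_of_lcpLength_lt (s := 4) (by omega) hhi⟩

end Blocks

/-! ### Thresholds -/

namespace Trip

/-- `min Γ_{j,m,1}` as a linear form: `θ⁷`, `θ⁴`, `θ¹`. -/
def start (s : Trip) : Idx → ℤ
  | .one => s.θ7
  | .two => s.θ4
  | .three => s.θ1

/-- The least position of the block `j` that the shift by `t_{m-1}` moves into a block `Γ₂`:
`θ⁸`, `θ⁵`, `θ²`. -/
def toTwo (s : Trip) : Idx → ℤ
  | .one => s.θ8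
  | .two => s.θ5
  | .three => s.θ2

/-- The least position of the block `j` that the shift by `t_{m-1}` moves into a block `Γ₁`:
`θ⁹`, `θ⁶`, `θ³`. -/
def toOne (s : Trip) : Idx → ℤ
  | .one => s.θ9
  | .two => s.θ6
  | .three => s.θ3

/-- The linear form of `cut`: `η³`, `η²`, `η¹`. -/
def switch (s : Trip) : Idx → ℤ
  | .one => s.η3
  | .two => s.η2
  | .three => s.η1

end Trip

section Thresholds

open Trip

lemma start_ofLevel (j : Idx) (r : ℕ) : (ofLevel (r + 4)).start j = lo j r + 1 := by
  have := two_mul_lcpLength r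
  cases j <;> simp only [start, θ1, θ4, θ7, ofLevel, lo, depth, Nat.reduceSubDiff,
    Nat.add_sub_cancel, lcpLength_succ, t_add_three, add_assoc, Nat.reduceAdd] at * <;> omega

lemma θ10_ofLevel (r : ℕ) : (ofLevel (r + 4)).θ10 = hi .one r + 1 := by
  have := two_mul_lcpLength r
  simp only [θ10, ofLevel, hi, depth, Nat.reduceSubDiff, lcpLength_succ, t_add_three, add_assoc,
    Nat.reduceAdd] at *
  omega

lemma switch_ofLevel (j : Idx) (r : ℕ) : (ofLevel (r + 4)).switch j = cut j r := by
  cases j <;> simp only [switch, η1, η2, η3, ofLevel, cut, Nat.reduceSubDiff, t_add_three,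
    add_assoc, Nat.reduceAdd] <;> omega

lemma toTwo_ofLevel (j : Idx) (q : ℕ) :
    (ofLevel (q + depth j + 4)).toTwo j = t (q + depth j + 3) + hi .three q + 1 := by
  have := two_mul_lcpLength q
  cases j <;> simp only [toTwo, θ2, θ5, θ8, ofLevel, hi, depth, Nat.reduceAdd, Nat.reduceSubDiff,
    lcpLength_succ, t_add_three, add_assoc] at * <;> omega

lemma toOne_ofLevel (j : Idx) (q : ℕ) :
    (ofLevel (q + depth j + 4)).toOne j = t (q + depth j + 3) + hi .two q + 1 := by
  have := two_mul_lcpLength q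
  cases j <;> simp only [toOne, θ3, θ6, θ9, ofLevel, hi, depth, Nat.reduceAdd, Nat.reduceSubDiff,
    lcpLength_succ, t_add_three, add_assoc] at * <;> omega

lemma cut_one_succ (q : ℕ) : cut .one (q + 1) + k (q + 5) = lo .one (q + 1) + t (q + 3) + 2 := by
  rw [k_add_four (q + 1)]
  simp only [cut, lo, depth, Nat.reduceSubDiff, lcpLength_succ, t_add_three, add_assoc,
    Nat.reduceAdd]
  omega

lemma cut_two_add_two (q : ℕ) :
    cut .two (q + 2) + k (q + 6) = lo .two (q + 2) + t (q + 3) + 2 := by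
  rw [k_add_four (q + 2)]
  simp only [cut, lo, depth, Nat.reduceSubDiff, lcpLength_succ, t_add_three, add_assoc,
    Nat.reduceAdd]
  omega

lemma cut_three_add_three (q : ℕ) :
    cut .three (q + 3) + k (q + 4) = lo .three (q + 3) + t (q + 3) + 2 := by
  rw [k_add_four q]
  simp only [cut, lo, depth, Nat.reduceSubDiff, lcpLength_succ, t_add_three, add_assoc,
    Nat.reduceAdd]
  omega

variable {m : ℕ}

theorem blocks_explicit (hm : 4 ≤ m) :
    ((gMin .three m 1 : ℤ) = (ofLevel m).θ1 ∧ (gMax .three m 1 : ℤ) + 1 = (ofLevel m).θ4) ∧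
    ((gMin .two m 1 : ℤ) = (ofLevel m).θ4 ∧ (gMax .two m 1 : ℤ) + 1 = (ofLevel m).θ7) ∧
    ((gMin .one m 1 : ℤ) = (ofLevel m).θ7 ∧ (gMax .one m 1 : ℤ) + 1 = (ofLevel m).θ10) ∧
    (block .one m 1).length = t (m - 2) ∧
    (block .two m 1).length = t (m - 3) ∧
    (block .three m 1).length = t (m - 4) := by
  obtain ⟨r, rfl⟩ := Nat.exists_eq_add_of_le' hm
  simp only [gMin_eq, gMax_eq, length_block]
  exact ⟨⟨(start_ofLevel .three r).symm, (start_ofLevel .two r).symm⟩,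
    ⟨(start_ofLevel .two r).symm, (start_ofLevel .one r).symm⟩,
    ⟨(start_ofLevel .one r).symm, (θ10_ofLevel r).symm⟩, rfl, rfl, rfl⟩

lemma gMin_add_depth (j : Idx) (q : ℕ) :
    gMin j (q + depth j + 4) 1 = gMin .three (q + 4) 1 + t (q + depth j + 3) := by
  rw [gMin_eq, gMin_eq, lo_add_depth, lo_three, add_comm (t _), add_right_comm]

lemma toTwo_eq_gMin_add (j : Idx) (q : ℕ) :
    (ofLevel (q + depth j + 4)).toTwo j =
      gMin j (q + depth j + 4) 1 + (block .three (q + 4) 1).length := by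
  rw [toTwo_ofLevel, gMin_add_depth, gMin_eq, length_block, hi_eq_lo_add]
  push_cast
  ring

lemma toOne_eq_gMin_add (j : Idx) (q : ℕ) :
    (ofLevel (q + depth j + 4)).toOne j = gMin j (q + depth j + 4) 1 +
      (block .three (q + 4) 1).length + (block .two (q + 4) 1).length := by
  rw [toOne_ofLevel, gMin_add_depth, gMin_eq, length_block, length_block, hi_eq_lo_add .two]
  change _ + ((hi .three q + _ : ℕ) : ℤ) + 1 = _
  rw [hi_eq_lo_add]
  push_cast
  ring

theorem thresholds_three (hm : 7 ≤ m) :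
    (ofLevel m).θ2 = gMin .three m 1 + (block .three (m - 3) 1).length ∧
    (ofLevel m).θ3 = gMin .three m 1 + (block .three (m - 3) 1).length
      + (block .two (m - 3) 1).length ∧
    (ofLevel m).η1 = gMin .three m 1 + t (m - 4) - k (m - 3) + 1 ∧
    (ofLevel m).θ3 < (ofLevel m).η1 ∧ (ofLevel m).η1 < (ofLevel m).θ4 ∧
    gMin .three m 1 = gMin .three (m - 3) 1 + t (m - 1) := by
  obtain ⟨q, rfl⟩ := Nat.exists_eq_add_of_le' hm
  have hθ3 : (ofLevel (q + 7)).θ3 = _ := toOne_ofLevel .three q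
  have hη1 : (ofLevel (q + 7)).η1 = _ := switch_ofLevel .three (q + 3)
  have hθ4 : (ofLevel (q + 7)).θ4 = _ := start_ofLevel .two (q + 3)
  have hlcp := two_mul_lcpLength q
  refine ⟨toTwo_eq_gMin_add .three q, toOne_eq_gMin_add .three q, ?_, ?_, ?_,
    gMin_add_depth .three q⟩
  · have hcut := cut_three_add_three q
    simp only [hη1, gMin_eq .three (q + 3), Nat.reduceSubDiff]
    omega
  · rw [hθ3, hη1]
    simp only [depth, hi, cut, Nat.reduceSubDiff, lcpLength_succ, t_add_three, add_assoc,
      Nat.reduceAdd] at *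
    omega
  · rw [hη1, hθ4]
    simp only [depth, lo, cut, Nat.reduceSubDiff, lcpLength_succ, t_add_three, add_assoc,
      Nat.reduceAdd] at *
    omega

theorem thresholds_two (hm : 6 ≤ m) :
    (ofLevel m).θ5 = gMin .two m 1 + (block .three (m - 2) 1).length ∧
    (ofLevel m).η2 = gMin .two m 1 + t (m - 3) - k m + 1 ∧
    (ofLevel m).θ6 = gMin .two m 1 + (block .three (m - 2) 1).length
      + (block .two (m - 2) 1).length ∧
    (ofLevel m).θ5 < (ofLevel m).η2 ∧ (ofLevel m).η2 ≤ (ofLevel m).θ6 ∧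
    gMin .two m 1 = gMin .three (m - 2) 1 + t (m - 1) := by
  obtain ⟨q, rfl⟩ := Nat.exists_eq_add_of_le' hm
  have hθ5 : (ofLevel (q + 6)).θ5 = _ := toTwo_ofLevel .two q
  have hη2 : (ofLevel (q + 6)).η2 = _ := switch_ofLevel .two (q + 2)
  have hθ6 : (ofLevel (q + 6)).θ6 = _ := toOne_ofLevel .two q
  have hlcp := two_mul_lcpLength q
  have hle := t_le_lcpLength_add_one (q + 2)
  refine ⟨toTwo_eq_gMin_add .two q, ?_, toOne_eq_gMin_add .two q, ?_, ?_,
    gMin_add_depth .two q⟩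
  · have hcut := cut_two_add_two q
    simp only [hη2, gMin_eq .two (q + 2), Nat.reduceSubDiff]
    omega
  · rw [hθ5, hη2]
    simp only [depth, hi, cut, Nat.reduceSubDiff, lcpLength_succ, t_add_three, add_assoc,
      Nat.reduceAdd] at *
    omega
  · rw [hη2, hθ6]
    simp only [depth, hi, cut, Nat.reduceSubDiff, lcpLength_succ, t_add_three, add_assoc,
      Nat.reduceAdd] at *
    omega

theorem thresholds_one (hm : 5 ≤ m) :
    (ofLevel m).θ8 = gMin .one m 1 + (block .three (m - 1) 1).length ∧
    (ofLevel m).θ9 = gMin .one m 1 + (block .three (m - 1) 1).length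
      + (block .two (m - 1) 1).length ∧
    (ofLevel m).η3 = gMin .one m 1 + t (m - 2) - k m + 1 ∧
    (ofLevel m).θ9 < (ofLevel m).η3 ∧ (ofLevel m).η3 < (ofLevel m).θ10 ∧
    gMin .one m 1 = gMin .three (m - 1) 1 + t (m - 1) := by
  obtain ⟨q, rfl⟩ := Nat.exists_eq_add_of_le' hm
  have hθ9 : (ofLevel (q + 5)).θ9 = _ := toOne_ofLevel .one q
  have hη3 : (ofLevel (q + 5)).η3 = _ := switch_ofLevel .one (q + 1)
  have hθ10 : (ofLevel (q + 5)).θ10 = _ := θ10_ofLevel (q + 1)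
  have hlcp := two_mul_lcpLength q
  refine ⟨toTwo_eq_gMin_add .one q, toOne_eq_gMin_add .one q, ?_, ?_, ?_,
    gMin_add_depth .one q⟩
  · have hcut := cut_one_succ q
    simp only [hη3, gMin_eq .one (q + 1), Nat.reduceSubDiff]
    omega
  · rw [hθ9, hη3]
    simp only [depth, hi, cut, Nat.reduceSubDiff, lcpLength_succ, t_add_three, add_assoc,
      Nat.reduceAdd] at *
    omega
  · have := t_pos q
    rw [hη3, hθ10]
    simp only [depth, hi, cut, Nat.reduceSubDiff, lcpLength_succ, t_add_three, add_assoc,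
      Nat.reduceAdd] at *
    omega

end Thresholds

/-! ### The recursive description of `b` -/

section Recursion

variable {j : Idx} {m n r : ℕ}

lemma b_eq_zero (hn : n ≤ 7) : b n = 0 := by
  obtain ⟨h₀, h₁, h₂, h₃, h₄, h₅, h₆⟩ := letter_initial
  rw [b_eq_ncard_periods, Set.ncard_eq_zero (finite_periods n), Set.eq_empty_iff_forall_notMem]
  rintro l ⟨hl, s, rfl, hs⟩
  have hne : ∀ i < l, letter (s + i) = letter (s + l + i) := hs
  have hl3 : l ≤ 3 := by omega
  have hs5 : s ≤ 5 := by omega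
  have hfirst := hne 0 hl
  have hlast := hne (l - 1) (by omega)
  interval_cases l <;> interval_cases s <;> simp_all

lemma b_eq_gain (hr : r < depth j) (hlo : lo j r < n) (hhi : n ≤ hi j r) : b n = gain j r n := by
  have hshift : n - t (r + 3) ≤ lcpLength 3 :=
    (Nat.sub_le_iff_le_add'.2 hhi).trans (lcpLength_strictMono.monotone (by omega))
  rw [b_eq_add_gain hlo hhi, b_eq_zero hshift, zero_add]

lemma map_b_eq_map_gain (hr : r < depth j) {s : List ℕ}
    (hs : ∀ n ∈ s, lo j r < n ∧ n ≤ hi j r) : s.map b = s.map (gain j r) :=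
  List.map_congr_left fun n hn => b_eq_gain hr (hs n hn).1 (hs n hn).2

theorem b_initial :
    (∀ i ≤ 7, b i = 0) ∧ [8].map b = [1] ∧ [9, 10].map b = [0, 1] ∧
      [11, 12, 13, 14].map b = [0, 0, 0, 1] ∧ [15, 16].map b = [1, 1] ∧
      [17, 18, 19, 20].map b = [0, 0, 1, 1] ∧ [28, 29, 30, 31].map b = [1, 1, 1, 1] := by
  refine ⟨fun i => b_eq_zero, ?_, ?_, ?_, ?_, ?_, ?_⟩
  · rw [map_b_eq_map_gain (j := .three) (r := 0)] <;> decide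
  · rw [map_b_eq_map_gain (j := .two) (r := 0)] <;> decide
  · rw [map_b_eq_map_gain (j := .one) (r := 0)] <;> decide
  · rw [map_b_eq_map_gain (j := .three) (r := 1)] <;> decide
  · rw [map_b_eq_map_gain (j := .two) (r := 1)] <;> decide
  · rw [map_b_eq_map_gain (j := .three) (r := 2)] <;> decide

lemma gain_eq_initB (j : Idx) :
    ∀ r < depth j, ∀ n ≤ hi j r, lo j r < n → (gain j r n : ℤ) = initB n := by
  cases j <;> decide

lemma b_eq_initB (hr : r < depth j) (hlo : lo j r < n) (hhi : n ≤ hi j r) :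
    (b n : ℤ) = initB n := by
  rw [b_eq_gain hr hlo hhi, gain_eq_initB j r hr n hhi hlo]

lemma map_range'_eq_zipWith {g : ℕ → ℕ} {s s' p q c d : ℕ}
    (h : ∀ i < p + q, g (s + i) = g (s' + i) + if i < p then c else d) :
    (List.range' s (p + q)).map g = List.zipWith (· + ·) ((List.range' s' (p + q)).map g)
      (List.replicate p c ++ List.replicate q d) := by
  refine List.ext_getElem (by simp) fun i hi _ => ?_
  have hi : i < p + q := by simpa using hi
  simp [List.getElem_append, h i hi]

lemma bVec_eq (j : Idx) (r : ℕ) :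
    bVec j (r + 4) = (List.range' (lo j r + 1) (t (r + 3 - depth j))).map b := by
  rw [bVec, block_eq]

lemma bCat_eq (r : ℕ) : bCat (r + 4) = (List.range' (lcpLength (r + 3) + 1) (t (r + 3))).map b := by
  have htwo : lo .two r + 1 = lo .three r + 1 + t r :=
    (congrArg (· + 1) (hi_eq_lo_add .three r)).trans (add_right_comm ..)
  have hone : lo .one r + 1 = lo .two r + 1 + t (r + 1) :=
    (congrArg (· + 1) (hi_eq_lo_add .two r)).trans (add_right_comm ..)
  have hlen : t (r + 3) = t r + t (r + 1) + t (r + 2) := by rw [t_add_three]; ring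
  rw [bCat, bVec_eq, bVec_eq, bVec_eq, ← List.map_append, ← List.map_append, hone, htwo]
  simp only [depth, Nat.reduceSubDiff, Nat.add_sub_cancel]
  rw [List.range'_append_1, add_assoc (lo .three r + 1), List.range'_append_1, hlen, lo_three]

lemma bVec_add_depth {p q c d : ℕ} (hlen : p + q = t (r + 3))
    (hgain : ∀ i < p + q,
      gain j (r + depth j) (lo j (r + depth j) + 1 + i) = if i < p then c else d) :
    bVec j (r + depth j + 4) = List.zipWith (· + ·) (bCat (r + 4))
      (List.replicate p c ++ List.replicate q d) := by
  have hblock : r + depth j + 3 - depth j = r + 3 := by omega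
  rw [bVec_eq, bCat_eq, hblock, ← hlen]
  refine map_range'_eq_zipWith fun i hi => ?_
  have hhi := hi_eq_lo_add j (r + depth j)
  rw [hblock] at hhi
  rw [b_eq_add_gain (j := j) (r := r + depth j) (by omega) (by omega), hgain i hi, lo_add_depth]
  congr 2
  omega

theorem bVec_one (hm : 5 ≤ m) : bVec .one m = List.zipWith (· + ·) (bCat (m - 1))
    (List.replicate (t (m - 2) + 1 - k m) 0 ++ List.replicate (k m - 1) 1) := by
  obtain ⟨r, rfl⟩ := Nat.exists_eq_add_of_le' hm
  have hk : k (r + 5) = lcpLength (r + 1) + 2 := k_add_four (r + 1)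
  have hlt : lcpLength (r + 1) < t (r + 2) := lcpLength_lt_t_succ (r + 1)
  have hle : t (r + 2) < t (r + 3) := t_strictMono (Nat.lt_add_one _)
  have hcut := cut_one_succ r
  refine bVec_add_depth (j := .one) (by simp only [Nat.reduceSubDiff]; omega) fun i hi => ?_
  change gain .one (r + 1) (lo .one (r + 1) + 1 + i) = _
  simp only [gain, Nat.reduceSubDiff] at hi ⊢
  split_ifs <;> omega

theorem bVec_two (hm : 6 ≤ m) : bVec .two m = List.zipWith (· + ·) (bCat (m - 2))
    (List.replicate (t (m - 3) + 1 - k m) 0 ++ List.replicate (k m - 1) 1) := by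
  obtain ⟨r, rfl⟩ := Nat.exists_eq_add_of_le' hm
  have hk : k (r + 6) = lcpLength (r + 2) + 2 := k_add_four (r + 2)
  have hlt : lcpLength (r + 2) < t (r + 3) := lcpLength_lt_t_succ (r + 2)
  have hcut := cut_two_add_two r
  refine bVec_add_depth (j := .two) (by simp only [Nat.reduceSubDiff]; omega) fun i hi => ?_
  change gain .two (r + 2) (lo .two (r + 2) + 1 + i) = _
  simp only [gain, Nat.reduceSubDiff] at hi ⊢
  split_ifs <;> omega

theorem bVec_three (hm : 7 ≤ m) : bVec .three m = List.zipWith (· + ·) (bCat (m - 3))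
    (List.replicate (t (m - 4) + 1 - k (m - 3)) 1 ++ List.replicate (k (m - 3) - 1) 0) := by
  obtain ⟨r, rfl⟩ := Nat.exists_eq_add_of_le' hm
  have hk : k (r + 4) = lcpLength r + 2 := k_add_four r
  have hlt : lcpLength r < t (r + 1) := lcpLength_lt_t_succ r
  have hle : t (r + 1) < t (r + 3) := t_strictMono (by omega)
  have hcut := cut_three_add_three r
  refine bVec_add_depth (j := .three) (by simp only [Nat.reduceSubDiff]; omega) fun i hi => ?_
  change gain .three (r + 3) (lo .three (r + 3) + 1 + i) = _
  simp only [gain, Nat.reduceSubDiff] at hi ⊢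
  split_ifs <;> omega

end Recursion

open Trip (ofLevel)

/-! ### Block sums and closed forms -/

section ClosedForms

variable {j : Idx} {m n r : ℕ}

lemma B_succ (n : ℕ) : B (n + 1) = B n + b (n + 1) := by
  rw [B_eq_sum, B_eq_sum, Finset.sum_Icc_succ_top (Nat.le_add_left 1 n)]

lemma B_eq_zero (hn : n ≤ 7) : B n = 0 := by
  rw [B_eq_sum]
  exact Finset.sum_eq_zero fun i hi => b_eq_zero ((Finset.mem_Icc.1 hi).2.trans hn)

lemma sum_Icc_b_add_B {a : ℕ} (h : a ≤ n) : ∑ i ∈ Finset.Icc (a + 1) n, b i + B a = B n := by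
  induction n, h using Nat.le_induction with
  | base => rw [Finset.Icc_eq_empty (Nat.not_succ_le_self a), Finset.sum_empty, zero_add]
  | succ n h ih =>
    rw [Finset.sum_Icc_succ_top (Nat.succ_le_succ h), B_succ, ← ih, add_right_comm]

lemma part_eq (h : lo j r ≤ n) : part j (r + 4) n = (B n : ℚ) - B (lo j r) := by
  rw [part, gMin_eq, ← sum_Icc_b_add_B h]
  push_cast
  ring

lemma bSum_eq_part (j : Idx) (r : ℕ) : (bSum j (r + 4) : ℚ) = part j (r + 4) (hi j r) := by
  have hrange : Finset.Icc (lo j r + 1) (hi j r) =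
      (List.range' (lo j r + 1) (t (r + 3 - depth j))).toFinset := by
    ext i
    simp only [Finset.mem_Icc, List.mem_toFinset, List.mem_range'_1, hi_eq_lo_add]
    omega
  rw [part, gMin_eq, hrange, List.sum_toFinset _ (List.nodup_range' (step := 1)), bSum, bVec_eq]
  simp [Nat.cast_list_sum, Function.comp_def]

lemma bSum_eq (j : Idx) (r : ℕ) : (bSum j (r + 4) : ℚ) = B (hi j r) - B (lo j r) := by
  rw [bSum_eq_part, part_eq (lo_lt_hi j r).le]

lemma B_add_B_lcpLength (hlo : lo j r ≤ n) (hhi : n ≤ hi j r) :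
    B n + B (lcpLength (r + 3 - depth j)) =
      B (n - t (r + 3)) + B (lo j r) + ∑ i ∈ Finset.Ioc (lo j r) n, gain j r i := by
  induction n, hlo using Nat.le_induction with
  | base => rw [Finset.Ioc_self, Finset.sum_empty, lo, Nat.add_sub_cancel_left, add_comm, add_zero]
  | succ n hn ih =>
    have ih := ih (Nat.le_of_succ_le hhi)
    have hshift : n + 1 - t (r + 3) = n - t (r + 3) + 1 := Nat.succ_sub ((t_le_lo j r).trans hn)
    have hb := b_eq_add_gain (Nat.lt_add_one_of_le hn) hhi
    rw [Finset.sum_Ioc_succ_top hn, B_succ, hb, hshift, B_succ]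
    omega

lemma lcpLength_lt_two_mul_t : ∀ r : ℕ, lcpLength r < 2 * t r
  | 0 => by decide
  | r + 1 => by
    have := lcpLength_lt_t_succ r
    have : t r < t (r + 1) := t_strictMono r.lt_add_one
    rw [lcpLength_succ]
    omega

lemma lo_lt_cut (j : Idx) (r : ℕ) : lo j r < cut j r := by
  have h₀ := lcpLength_lt_t_succ r
  have h₂ := lcpLength_lt_t_succ (r + 2)
  have hle := lcpLength_lt_two_mul_t r
  have hadd := t_add_three r
  cases j <;> simp only [lo, cut, depth, Nat.reduceSubDiff, Nat.add_sub_cancel, lcpLength_succ,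
    add_assoc, Nat.reduceAdd] at * <;> omega

lemma sum_Ioc_gain (hj : j ≠ .three) (hn : lo j r ≤ n) :
    ∑ i ∈ Finset.Ioc (lo j r) n, gain j r i = n + 1 - cut j r := by
  have hgain (i : ℕ) : gain j r i = if cut j r ≤ i then 1 else 0 := by
    cases j <;> first | rfl | exact (hj rfl).elim
  have hcut := lo_lt_cut j r
  induction n, hn using Nat.le_induction with
  | base => rw [Finset.Ioc_self, Finset.sum_empty]; omega
  | succ n hn ih => rw [Finset.sum_Ioc_succ_top hn, ih, hgain]; split_ifs <;> omega

lemma sum_Ioc_gain_three (hn : lo .three r ≤ n) :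
    ∑ i ∈ Finset.Ioc (lo .three r) n, gain .three r i = min n (cut .three r - 1) - lo .three r := by
  have hcut := lo_lt_cut .three r
  induction n, hn using Nat.le_induction with
  | base => rw [Finset.Ioc_self, Finset.sum_empty]; omega
  | succ n hn ih => rw [Finset.sum_Ioc_succ_top hn, ih, gain]; split_ifs <;> omega

lemma B_hi_add (hj : j ≠ .three) (r : ℕ) : B (hi j r) + B (lcpLength (r + 3 - depth j)) =
    B (lcpLength (r + 4 - depth j)) + B (lo j r) + (lcpLength r + 1) := by
  have h := B_add_B_lcpLength (lo_lt_hi j r).le le_rfl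
  rw [sum_Ioc_gain hj (lo_lt_hi j r).le] at h
  have hgain : hi j r + 1 - cut j r = lcpLength r + 1 := by
    have hadd := t_add_three r
    cases j <;> simp only [hi, cut, depth, Nat.reduceSubDiff, lcpLength_succ, add_assoc,
      ne_eq, not_true_eq_false] at * <;> omega
  rwa [hgain, hi, Nat.add_sub_cancel_left, ← hi] at h

lemma B_hi_three_add (r : ℕ) : B (hi .three r) + B (lcpLength r) + (lcpLength r + 1) =
    B (lcpLength (r + 1)) + B (lcpLength (r + 3)) + 2 * t r := by
  have h := B_add_B_lcpLength (lo_lt_hi .three r).le le_rfl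
  rw [sum_Ioc_gain_three (lo_lt_hi .three r).le] at h
  have hgain : min (hi .three r) (cut .three r - 1) - lo .three r + (lcpLength r + 1) =
      2 * t r := by
    have := lo_lt_cut .three r
    have := t_le_lcpLength_add_one r
    simp only [lo, hi, cut, depth, Nat.reduceSubDiff, Nat.add_sub_cancel, lcpLength_succ] at *
    omega
  rw [lo_three, hi, Nat.add_sub_cancel_left, ← hi] at h
  rw [lo_three] at hgain
  simp only [depth, Nat.reduceSubDiff, Nat.add_sub_cancel] at h
  omega

lemma B_lcpLength_add_four (r : ℕ) : B (lcpLength (r + 4)) + B (lcpLength r) =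
    2 * B (lcpLength (r + 3)) + 2 * t r + lcpLength r + 1 := by
  have h₁ := B_hi_add (j := .one) (by decide) r
  have h₂ := B_hi_add (j := .two) (by decide) r
  have h₃ := B_hi_three_add r
  rw [hi_one] at h₁
  change _ = _ + B (hi .two r) + _ at h₁
  change _ = _ + B (hi .three r) + _ at h₂
  simp only [depth, Nat.reduceSubDiff] at h₁ h₂
  omega

lemma cast_lcpLength (r : ℕ) : (lcpLength r : ℚ) = ((t (r + 2) : ℚ) - t r - 3) / 2 := by
  have h : 2 * lcpLength r + 3 + t r = t (r + 2) := by
    have := two_mul_lcpLength r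
    rw [lcpLength_succ] at this
    omega
  rw [← h]
  push_cast
  ring

theorem B_lcpLength : ∀ r : ℕ, (B (lcpLength r) : ℚ) =
    (r : ℚ) / 44 * (-15 * t r + 8 * t (r + 1) + 5 * t (r + 2))
      + 1 / 44 * (105 * t r - 51 * t (r + 2)) + ((r : ℚ) + 9) / 4
  | 0 | 1 | 2 | 3 => by
    rw [B_eq_zero (by decide)]
    simp only [t_add_three, zero_add, Nat.reduceAdd,
      (by decide : t 0 = 1), (by decide : t 1 = 2), (by decide : t 2 = 4)]
    norm_num
  | r + 4 => by
    have hrec : (B (lcpLength (r + 4)) : ℚ) + B (lcpLength r) =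
        2 * B (lcpLength (r + 3)) + 2 * t r + lcpLength r + 1 :=
      mod_cast B_lcpLength_add_four r
    rw [B_lcpLength (r + 3), B_lcpLength r, cast_lcpLength r] at hrec
    rw [eq_sub_of_add_eq hrec]
    simp only [t_add_three, add_assoc, Nat.reduceAdd]
    push_cast
    ring

lemma B_hi_eq_maxForm (j : Idx) (r : ℕ) : (B (hi j r) : ℚ) = (ofLevel (r + 4)).maxForm j := by
  have hone : (B (hi .one r) : ℚ) = B (lcpLength (r + 4)) := by rw [hi_one]
  have htwo : (B (hi .two r) : ℚ) + B (lcpLength (r + 1)) =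
      B (lcpLength (r + 2)) + B (hi .three r) + (lcpLength r + 1) :=
    mod_cast B_hi_add (j := .two) (by decide) r
  have hthree : (B (hi .three r) : ℚ) + B (lcpLength r) + (lcpLength r + 1) =
      B (lcpLength (r + 1)) + B (lcpLength (r + 3)) + 2 * t r :=
    mod_cast B_hi_three_add r
  rw [← eq_sub_iff_add_eq, ← eq_sub_iff_add_eq] at hthree
  rw [← eq_sub_iff_add_eq, hthree] at htwo
  cases j <;> simp only [hone, htwo, hthree, B_lcpLength, cast_lcpLength, Trip.maxForm, Trip.form,
    ofLevel, Nat.reduceSubDiff, t_add_three, add_assoc, Nat.reduceAdd] <;> push_cast <;> ring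

lemma bSum_eq_sumForm (j : Idx) (r : ℕ) : (bSum j (r + 4) : ℚ) = (ofLevel (r + 4)).sumForm j := by
  have hone : (B (lo .one r) : ℚ) = _ := B_hi_eq_maxForm .two r
  have htwo : (B (lo .two r) : ℚ) = _ := B_hi_eq_maxForm .three r
  rw [bSum_eq, B_hi_eq_maxForm]
  cases j <;> simp only [hone, htwo, lo_three, B_lcpLength, Trip.maxForm, Trip.sumForm, Trip.form,
    ofLevel, Nat.reduceSubDiff, t_add_three, add_assoc, Nat.reduceAdd] <;> push_cast <;> ring

lemma Phi_eq (r : ℕ) : (Phi (r + 4) : ℚ) = B (lcpLength (r + 4)) - B (lcpLength (r + 3)) := by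
  have hone : (bSum .one (r + 4) : ℚ) = _ - B (hi .two r) := bSum_eq .one r
  have htwo : (bSum .two (r + 4) : ℚ) = _ - B (hi .three r) := bSum_eq .two r
  rw [Phi, ← hi_one, ← lo_three]
  push_cast
  rw [hone, htwo, bSum_eq]
  ring

lemma sum_Phi_eq (r : ℕ) : ∑ i ∈ Finset.Icc 4 (r + 3), (Phi i : ℚ) = B (lcpLength (r + 3)) := by
  induction r with
  | zero => rw [B_eq_zero (by decide)]; rfl
  | succ r ih =>
    rw [add_right_comm, Finset.sum_Icc_succ_top (by omega), ih, Phi_eq]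
    ring

theorem closed_forms (hm : 4 ≤ m) :
    (Phi m : ℚ) = (ofLevel m).phiForm ∧
      (∀ j : Idx, (bSum j m : ℚ) = (ofLevel m).sumForm j) ∧
      (∑ i ∈ Finset.Icc 4 (m - 1), (Phi i : ℚ)) = (ofLevel m).phiSumForm ∧
      (∀ j : Idx, (B (gMax j m 1) : ℚ) = (ofLevel m).maxForm j) := by
  obtain ⟨r, rfl⟩ := Nat.exists_eq_add_of_le' hm
  refine ⟨?_, fun j => bSum_eq_sumForm j r, ?_, fun j => by rw [gMax_eq, B_hi_eq_maxForm]⟩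
  · simp only [Phi, Nat.cast_add, bSum_eq_sumForm, Trip.sumForm, Trip.phiForm, Trip.form]
    ring
  · simp only [Nat.reduceSubDiff, sum_Phi_eq, B_lcpLength, Trip.phiSumForm, Trip.form, ofLevel,
      t_add_three, add_assoc, Nat.reduceAdd]
    push_cast
    ring

end ClosedForms

/-! ### Reduction of the partial block sums -/

section Reduction

variable {j : Idx} {m n q r : ℕ}

theorem B_eq_B_add_part (hm : 4 ≤ m) (h : n ∈ block j m 1) :
    (B n : ℚ) = B (gMin j m 1 - 1) + part j m n := by
  obtain ⟨r, rfl⟩ := Nat.exists_eq_add_of_le' hm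
  rw [gMin_eq, Nat.add_sub_cancel, part_eq (mem_block_iff.1 h).1.le, add_sub_cancel]

lemma part_three_eq (h : lo .three q ≤ n) :
    part .three (q + 4) n = B n - B (lcpLength (q + 3)) := by
  rw [part_eq h, lo_three]

lemma part_two_add (h : lo .two q ≤ n) :
    part .two (q + 4) n + bSum .three (q + 4) = B n - B (lcpLength (q + 3)) := by
  rw [part_eq h, bSum_eq, lo_three]
  exact sub_add_sub_cancel ..

lemma part_one_add (h : lo .one q ≤ n) :
    part .one (q + 4) n + bSum .three (q + 4) + bSum .two (q + 4) =
      B n - B (lcpLength (q + 3)) := by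
  have htwo : (bSum .two (q + 4) : ℚ) = part .two (q + 4) (lo .one q) := bSum_eq_part .two q
  rw [add_assoc, add_comm (bSum .three (q + 4) : ℚ), htwo,
    part_two_add (n := lo .one q) (lo_lt_hi .two q).le, part_eq h, sub_add_sub_cancel]

lemma part_add_depth (h : lo j (q + depth j) ≤ n) (h' : n ≤ hi j (q + depth j)) :
    part j (q + depth j + 4) n = B (n - t (q + depth j + 3)) - B (lcpLength (q + 3)) +
      ((∑ i ∈ Finset.Ioc (lo j (q + depth j)) n, gain j (q + depth j) i : ℕ) : ℚ) := by
  have hB := congrArg (Nat.cast (R := ℚ)) (B_add_B_lcpLength h h')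
  rw [show q + depth j + 3 - depth j = q + 3 by omega, Nat.cast_add, Nat.cast_add,
    Nat.cast_add] at hB
  rw [part_eq h]
  linarith

theorem part_one (hm : 5 ≤ m) (h : n ∈ block .one m 1) :
    part .one m n =
      if (n : ℤ) < (ofLevel m).θ8 then
        part .three (m - 1) (n - t (m - 1))
      else if (n : ℤ) < (ofLevel m).θ9 then
        part .two (m - 1) (n - t (m - 1)) + bSum .three (m - 1)
      else if (n : ℤ) < (ofLevel m).η3 then
        part .one (m - 1) (n - t (m - 1)) + bSum .three (m - 1) + bSum .two (m - 1)
      else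
        part .one (m - 1) (n - t (m - 1)) + bSum .three (m - 1) + bSum .two (m - 1)
          + n - (ofLevel m).η3 + 1 := by
  obtain ⟨-, -, -, hθη, -⟩ := thresholds_one hm
  obtain ⟨r, rfl⟩ := Nat.exists_eq_add_of_le' hm
  obtain ⟨hlo, hhi⟩ := mem_block_iff (r := r + 1).1 h
  have hlt : lo .two r < lo .one r := lo_lt_hi .two r
  have hθ₈ : (ofLevel (r + 5)).θ8 = t (r + 4) + lo .two r + 1 := toTwo_ofLevel .one r
  have hθ₉ : (ofLevel (r + 5)).θ9 = t (r + 4) + lo .one r + 1 := toOne_ofLevel .one r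
  have hη : (ofLevel (r + 5)).η3 = cut .one (r + 1) := switch_ofLevel .one (r + 1)
  have hshift : lo .one (r + 1) = t (r + 4) + lo .three r := by
    rw [lo_three]; exact lo_add_depth .one r
  have hpart : part .one (r + 5) n =
      B (n - t (r + 4)) - B (lcpLength (r + 3)) + ((n + 1 - cut .one (r + 1) : ℕ) : ℚ) := by
    rw [← sum_Ioc_gain (by decide) hlo.le]
    exact part_add_depth (j := .one) hlo.le hhi
  simp only [Nat.reduceSubDiff, hθ₈, hθ₉, hη] at hθη ⊢
  rw [hpart]
  split_ifs with h₁ h₂ h₃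
  · rw [part_three_eq (by omega), Nat.sub_eq_zero_of_le (n := n + 1) (by omega),
      Nat.cast_zero, add_zero]
  · rw [part_two_add (by omega), Nat.sub_eq_zero_of_le (n := n + 1) (by omega),
      Nat.cast_zero, add_zero]
  · rw [part_one_add (by omega), Nat.sub_eq_zero_of_le (n := n + 1) (by omega),
      Nat.cast_zero, add_zero]
  · rw [part_one_add (by omega), Nat.cast_sub (by omega)]
    push_cast
    ring

theorem part_two (hm : 6 ≤ m) (h : n ∈ block .two m 1) :
    part .two m n =
      if (n : ℤ) < (ofLevel m).θ5 then
        part .three (m - 2) (n - t (m - 1))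
      else if (n : ℤ) < (ofLevel m).η2 then
        part .two (m - 2) (n - t (m - 1)) + bSum .three (m - 2)
      else if (n : ℤ) < (ofLevel m).θ6 then
        part .two (m - 2) (n - t (m - 1)) + bSum .three (m - 2) + n - (ofLevel m).η2 + 1
      else
        part .one (m - 2) (n - t (m - 1)) + bSum .three (m - 2) + bSum .two (m - 2)
          + n - (ofLevel m).η2 + 1 := by
  obtain ⟨-, -, -, hθη, hηθ, -⟩ := thresholds_two hm
  obtain ⟨r, rfl⟩ := Nat.exists_eq_add_of_le' hm
  obtain ⟨hlo, hhi⟩ := mem_block_iff (r := r + 2).1 h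
  have hθ₅ : (ofLevel (r + 6)).θ5 = t (r + 5) + lo .two r + 1 := toTwo_ofLevel .two r
  have hθ₆ : (ofLevel (r + 6)).θ6 = t (r + 5) + lo .one r + 1 := toOne_ofLevel .two r
  have hη : (ofLevel (r + 6)).η2 = cut .two (r + 2) := switch_ofLevel .two (r + 2)
  have hshift : lo .two (r + 2) = t (r + 5) + lo .three r := by
    rw [lo_three]; exact lo_add_depth .two r
  have hpart : part .two (r + 6) n =
      B (n - t (r + 5)) - B (lcpLength (r + 3)) + ((n + 1 - cut .two (r + 2) : ℕ) : ℚ) := by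
    rw [← sum_Ioc_gain (by decide) hlo.le]
    exact part_add_depth (j := .two) hlo.le hhi
  simp only [Nat.reduceSubDiff, hθ₅, hθ₆, hη] at hθη hηθ ⊢
  rw [hpart]
  split_ifs with h₁ h₂ h₃
  · rw [part_three_eq (by omega), Nat.sub_eq_zero_of_le (n := n + 1) (by omega),
      Nat.cast_zero, add_zero]
  · rw [part_two_add (by omega), Nat.sub_eq_zero_of_le (n := n + 1) (by omega),
      Nat.cast_zero, add_zero]
  · rw [part_two_add (by omega), Nat.cast_sub (by omega)]
    push_cast
    ring
  · rw [part_one_add (by omega), Nat.cast_sub (by omega)]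
    push_cast
    ring

lemma cut_three_sub_lo_three (r : ℕ) :
    (cut .three (r + 3) : ℚ) - 1 - lo .three (r + 3) =
      (-5 * (t (r + 7) : ℚ) + 10 * t (r + 6) - t (r + 5) + 1) / 2 := by
  rw [lo_three, cast_lcpLength]
  simp only [cut, t_add_three, add_assoc, Nat.reduceAdd]
  push_cast
  ring

theorem part_three (hm : 7 ≤ m) (h : n ∈ block .three m 1) :
    part .three m n =
      if (n : ℤ) < (ofLevel m).θ2 then
        part .three (m - 3) (n - t (m - 1)) + n - gMin .three m 1 + 1
      else if (n : ℤ) < (ofLevel m).θ3 then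
        part .two (m - 3) (n - t (m - 1)) + bSum .three (m - 3) + n - gMin .three m 1 + 1
      else if (n : ℤ) < (ofLevel m).η1 then
        part .one (m - 3) (n - t (m - 1)) + bSum .three (m - 3) + bSum .two (m - 3)
          + n - gMin .three m 1 + 1
      else
        part .one (m - 3) (n - t (m - 1)) + bSum .three (m - 3) + bSum .two (m - 3)
          + (-5 * (t m : ℚ) + 10 * t (m - 1) - t (m - 2) + 1) / 2 := by
  obtain ⟨-, -, -, hθη, -⟩ := thresholds_three hm
  obtain ⟨r, rfl⟩ := Nat.exists_eq_add_of_le' hm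
  obtain ⟨hlo, hhi⟩ := mem_block_iff (r := r + 3).1 h
  have hlt : lo .two r < lo .one r := lo_lt_hi .two r
  have hθ₂ : (ofLevel (r + 7)).θ2 = t (r + 6) + lo .two r + 1 := toTwo_ofLevel .three r
  have hθ₃ : (ofLevel (r + 7)).θ3 = t (r + 6) + lo .one r + 1 := toOne_ofLevel .three r
  have hη : (ofLevel (r + 7)).η1 = cut .three (r + 3) := switch_ofLevel .three (r + 3)
  have hshift : lo .three (r + 3) = t (r + 6) + lo .three r := by
    rw [lo_three r]; exact lo_add_depth .three r
  have hmin : gMin .three (r + 7) 1 = lo .three (r + 3) + 1 := gMin_eq .three (r + 3)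
  have hpart : part .three (r + 7) n = B (n - t (r + 6)) - B (lcpLength (r + 3)) +
      ((min n (cut .three (r + 3) - 1) - lo .three (r + 3) : ℕ) : ℚ) := by
    rw [← sum_Ioc_gain_three hlo.le]
    exact part_add_depth (j := .three) hlo.le hhi
  have hsum : (n : ℤ) < cut .three (r + 3) →
      ((min n (cut .three (r + 3) - 1) - lo .three (r + 3) : ℕ) : ℚ) =
        n - gMin .three (r + 7) 1 + 1 := fun hn => by
    rw [min_eq_left (by omega), Nat.cast_sub hlo.le, hmin]
    push_cast
    ring
  have hcut := lo_lt_cut .three (r + 3)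
  simp only [Nat.reduceSubDiff, hθ₂, hθ₃, hη] at hθη ⊢
  rw [hpart]
  split_ifs with h₁ h₂ h₃
  · rw [part_three_eq (by omega), hsum (by omega)]
    ring
  · rw [part_two_add (by omega), hsum (by omega)]
    ring
  · rw [part_one_add (by omega), hsum (by omega)]
    ring
  · rw [part_one_add (by omega), ← cut_three_sub_lo_three, min_eq_right (by omega),
      Nat.cast_sub (by omega), Nat.cast_sub (by omega), Nat.cast_one]

end Reduction

/-! ### The algorithms -/

section Algorithms

open Trip

variable {j : Idx} {n q r : ℕ}

lemma down_ofLevel (r : ℕ) : (ofLevel (r + 3)).down = ofLevel (r + 2) := by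
  simp only [ofLevel, down, Nat.reduceSubDiff, t_add_three]
  congr 1
  push_cast
  ring

lemma up_ofLevel (r : ℕ) : (ofLevel (r + 2)).up = ofLevel (r + 3) := by
  simp only [ofLevel, up, Nat.reduceSubDiff, Nat.add_sub_cancel, t_add_three, add_assoc,
    Nat.reduceAdd]
  push_cast
  rfl

lemma down_down_ofLevel (r : ℕ) : (ofLevel (r + 4)).down.down = ofLevel (r + 2) := by
  rw [down_ofLevel (r + 1), down_ofLevel r]

lemma down_down_down_ofLevel (r : ℕ) : (ofLevel (r + 5)).down.down.down = ofLevel (r + 2) := by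
  rw [down_ofLevel (r + 2), down_down_ofLevel r]

lemma idx_spec (h : lcpLength (r + 3) < n) (h' : n ≤ lcpLength (r + 4)) :
    lo ((ofLevel (r + 4)).idx n) r < n ∧ n ≤ hi ((ofLevel (r + 4)).idx n) r := by
  have hθ₄ : (ofLevel (r + 4)).θ4 = lo .two r + 1 := start_ofLevel .two r
  have hθ₇ : (ofLevel (r + 4)).θ7 = lo .one r + 1 := start_ofLevel .one r
  have hthree : hi .three r = lo .two r := rfl
  have htwo : hi .two r = lo .one r := rfl
  rw [← lo_three] at h
  rw [← hi_one] at h'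
  rw [idx, hθ₄, hθ₇]
  split_ifs <;> omega

lemma lt_θ10_ofLevel_iff : (n : ℤ) < (ofLevel (r + 4)).θ10 ↔ n ≤ lcpLength (r + 4) := by
  rw [θ10_ofLevel, hi_one, Int.lt_add_one_iff, Nat.cast_le]

lemma search_eq (d : ℕ) {fuel : ℕ} (hd : d ≤ fuel) (h : lcpLength (r + d + 3) < n)
    (h' : n ≤ lcpLength (r + d + 4)) :
    search fuel (ofLevel (r + 4)) n = (ofLevel (r + d + 4), d) := by
  induction d generalizing r fuel with
  | zero =>
    cases fuel with
    | zero => rfl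
    | succ fuel => rw [search, if_pos (lt_θ10_ofLevel_iff.2 h'), add_zero]
  | succ d ih =>
    obtain ⟨fuel, rfl⟩ := Nat.exists_eq_add_of_le' (Nat.le_of_add_left_le hd)
    rw [← add_assoc, add_right_comm r] at h h' ⊢
    have hlcp : lcpLength (r + 4) ≤ lcpLength (r + 1 + d + 3) :=
      lcpLength_strictMono.monotone (by omega)
    rw [search, if_neg (mt lt_θ10_ofLevel_iff.1 (hlcp.trans_lt h).not_ge), up_ofLevel (r + 2)]
    simp only [show search fuel (ofLevel (r + 2 + 3)) n = _ from
      ih (r := r + 1) (Nat.le_of_add_le_add_right hd) h h']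

lemma level_eq (h : lcpLength (r + 3) < n) (h' : n ≤ lcpLength (r + 4)) :
    level n = (ofLevel (r + 4), r) := by
  have hr : r ≤ n := (Nat.le_add_right r 3).trans (lcpLength_strictMono.le_apply.trans h.le)
  have hsearch := search_eq (r := 0) r hr (by rwa [zero_add]) (by rwa [zero_add])
  rwa [zero_add r] at hsearch

lemma lcpLength_lt_sub (hlo : lo j (q + depth j) < n) :
    lcpLength (q + 3) < n - t (q + depth j + 3) := by
  rw [lo_add_depth] at hlo
  omega

lemma sub_le_lcpLength (hhi : n ≤ hi j (q + depth j)) :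
    n - t (q + depth j + 3) ≤ lcpLength (q + 4) :=
  Nat.sub_le_iff_le_add'.2 (hhi.trans_eq (hi_add_depth j q))

lemma bBlock_of_lt_depth (hr : r < depth j) :
    (bBlock j (ofLevel (r + 4)) n).1 = initB n := by
  have hm : (ofLevel (r + 4)).m ≤ depth j + 3 := Nat.add_le_add_right hr 3
  cases j <;> simp only [depth, Nat.reduceAdd] at hm <;> rw [bBlock, if_pos hm]

lemma bBlock_add_depth (j : Idx) (hn : t (q + depth j + 3) ≤ n) :
    (bBlock j (ofLevel (q + depth j + 4)) n).1 =
      (bBlock ((ofLevel (q + 4)).idx (n - t (q + depth j + 3) : ℕ)) (ofLevel (q + 4))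
        (n - t (q + depth j + 3) : ℕ)).1 + gain j (q + depth j) n := by
  have hy : (n : ℤ) - (ofLevel (q + depth j + 4)).y = (n - t (q + depth j + 3) : ℕ) :=
    (Nat.cast_sub hn).symm
  have hm : ¬ (ofLevel (q + depth j + 4)).m ≤ depth j + 3 := by
    simp only [ofLevel]; omega
  have hswitch := switch_ofLevel j (q + depth j)
  cases j <;> simp only [depth, add_assoc, Nat.reduceAdd, switch] at * <;>
    rw [bBlock, if_neg hm] <;>
    simp only [hy, hswitch, gain, Nat.cast_le, Nat.cast_lt, Nat.cast_ite, Nat.cast_one,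
      Nat.cast_zero]
  · rw [down_ofLevel (q + 2)]
  · rw [down_down_ofLevel (q + 2)]
  · rw [down_down_down_ofLevel (q + 2)]

theorem bBlock_eq (hlo : lo j r < n) (hhi : n ≤ hi j r) :
    (bBlock j (ofLevel (r + 4)) n).1 = b n := by
  induction r using Nat.strong_induction_on generalizing j n with
  | _ r ih =>
    obtain hr | hr := lt_or_ge r (depth j)
    · rw [bBlock_of_lt_depth hr, b_eq_initB hr hlo hhi]
    obtain ⟨q, rfl⟩ := Nat.exists_eq_add_of_le' hr
    have hidx := idx_spec (lcpLength_lt_sub hlo) (sub_le_lcpLength hhi)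
    rw [bBlock_add_depth j ((t_le_lo ..).trans hlo.le), b_eq_add_gain hlo hhi,
      ih q (Nat.lt_add_of_pos_right (by cases j <;> decide)) hidx.1 hidx.2, Nat.cast_add]

theorem bAlg_eq (n : ℕ) : (bAlg n).1 = b n := by
  rw [bAlg]
  split_ifs with hn
  · rw [b_eq_zero hn, Nat.cast_zero]
  · obtain ⟨r, hr, hr'⟩ := exists_level (n := n) (by omega)
    simp only [level_eq hr hr']
    exact bBlock_eq (idx_spec hr hr').1 (idx_spec hr hr').2

lemma initSum_eq_sum_Icc (a n : ℕ) : initSum a n = ∑ i ∈ Finset.Icc a n, (initB i : ℚ) := by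
  have hcoe (s : List ℕ) : (do let i ← s; pure (i : ℤ)) = s.map Nat.cast :=
    List.map_eq_flatMap.symm
  have hlen : ((n : ℤ) + 1 - a).toNat = n + 1 - a := by omega
  rw [initSum, hcoe, hlen, List.map_map, ← Finset.Ico_add_one_right_eq_Icc,
    Finset.sum_Ico_eq_sum_range, ← List.sum_toFinset _ List.nodup_range, List.toFinset_range]
  simp only [Function.comp_apply, Nat.cast_add]

lemma part_eq_initSum (hr : r < depth j) (hhi : n ≤ hi j r) :
    part j (r + 4) n = initSum ((ofLevel (r + 4)).start j) n := by
  rw [start_ofLevel, ← Nat.cast_succ, initSum_eq_sum_Icc, part, gMin_eq]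
  refine Finset.sum_congr rfl fun i hi => ?_
  obtain ⟨hlo, hin⟩ := Finset.mem_Icc.1 hi
  rw [← b_eq_initB hr hlo (hin.trans hhi), Int.cast_natCast]

lemma partAlg_of_lt_depth (hr : r < depth j) :
    partAlg j (ofLevel (r + 4)) n = (initSum ((ofLevel (r + 4)).start j) n, 0) := by
  have hm : (ofLevel (r + 4)).m ≤ depth j + 3 := Nat.add_le_add_right hr 3
  cases j <;> simp only [depth, Nat.reduceAdd] at hm <;> rw [partAlg, if_pos hm] <;> rfl

/-- One step of `partAlg` from the position `n` in the block `j` of level `q + depth j + 4` calls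
`partAlg` for the position `n - t_{m-1}` in the block `j'` of level `q + 4` that contains it, and
returns the correct value if that call does. -/
def ReducesTo (j : Idx) (q n : ℕ) (j' : Idx) : Prop :=
  lo j' q < n - t (q + depth j + 3) ∧ n - t (q + depth j + 3) ≤ hi j' q ∧
  ((partAlg j' (ofLevel (q + 4)) (n - t (q + depth j + 3) : ℕ)).1 =
      part j' (q + 4) (n - t (q + depth j + 3)) →
    (partAlg j (ofLevel (q + depth j + 4)) n).1 = part j (q + depth j + 4) n) ∧
  (partAlg j (ofLevel (q + depth j + 4)) n).2 =
    (partAlg j' (ofLevel (q + 4)) (n - t (q + depth j + 3) : ℕ)).2 + 1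

lemma exists_reducesTo_one (hlo : lo .one (q + 1) < n) (hhi : n ≤ hi .one (q + 1)) :
    ∃ j', ReducesTo .one q n j' := by
  have hy : (n : ℤ) - (ofLevel (q + 5)).y = (n - t (q + 4) : ℕ) :=
    (Nat.cast_sub ((t_le_lo .one (q + 1)).trans hlo.le)).symm
  have hm : ¬ (ofLevel (q + 5)).m ≤ 4 := by simp only [ofLevel]; omega
  have hθ₈ : (ofLevel (q + 5)).θ8 = t (q + 4) + hi .three q + 1 := toTwo_ofLevel .one q
  have hθ₉ : (ofLevel (q + 5)).θ9 = t (q + 4) + hi .two q + 1 := toOne_ofLevel .one q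
  have hpart := part_one (m := q + 5) (by omega) (mem_block_iff.2 ⟨hlo, hhi⟩)
  have hfst : lo .three q < n - t (q + 4) := lo_three q ▸ lcpLength_lt_sub (j := .one) hlo
  have hlst : n - t (q + 4) ≤ hi .one q := hi_one q ▸ sub_le_lcpLength (j := .one) hhi
  simp only [Nat.reduceSubDiff] at hpart
  simp only [ReducesTo, depth, add_assoc, Nat.reduceAdd]
  rw [hpart, partAlg, if_neg hm]
  simp only [down_ofLevel (q + 2), hy, ← bSum_eq_sumForm]
  split_ifs with h₁ h₂ h₃
  · exact ⟨.three, hfst, by omega, fun h => h, rfl⟩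
  · exact ⟨.two, by change hi .three q < _; omega, by omega, fun h => by rw [h], rfl⟩
  · exact ⟨.one, by change hi .two q < _; omega, hlst, fun h => by rw [h], rfl⟩
  · exact ⟨.one, by change hi .two q < _; omega, hlst, fun h => by rw [h]; push_cast; rfl, rfl⟩

lemma exists_reducesTo_two (hlo : lo .two (q + 2) < n) (hhi : n ≤ hi .two (q + 2)) :
    ∃ j', ReducesTo .two q n j' := by
  have hy : (n : ℤ) - (ofLevel (q + 6)).y = (n - t (q + 5) : ℕ) :=
    (Nat.cast_sub ((t_le_lo .two (q + 2)).trans hlo.le)).symm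
  have hm : ¬ (ofLevel (q + 6)).m ≤ 5 := by simp only [ofLevel]; omega
  have hθ₅ : (ofLevel (q + 6)).θ5 = t (q + 5) + hi .three q + 1 := toTwo_ofLevel .two q
  have hθ₆ : (ofLevel (q + 6)).θ6 = t (q + 5) + hi .two q + 1 := toOne_ofLevel .two q
  have hpart := part_two (m := q + 6) (by omega) (mem_block_iff.2 ⟨hlo, hhi⟩)
  have hfst : lo .three q < n - t (q + 5) := lo_three q ▸ lcpLength_lt_sub (j := .two) hlo
  have hlst : n - t (q + 5) ≤ hi .one q := hi_one q ▸ sub_le_lcpLength (j := .two) hhi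
  obtain ⟨-, -, -, -, hηθ, -⟩ := thresholds_two (m := q + 6) (by omega)
  simp only [Nat.reduceSubDiff] at hpart
  simp only [ReducesTo, depth, add_assoc, Nat.reduceAdd]
  rw [hpart, partAlg, if_neg hm]
  simp only [down_down_ofLevel (q + 2), hy, ← bSum_eq_sumForm]
  split_ifs with h₁ h₂ h₃
  · exact ⟨.three, hfst, by omega, fun h => h, rfl⟩
  · exact ⟨.two, by change hi .three q < _; omega, by omega, fun h => by rw [h], rfl⟩
  · exact ⟨.two, by change hi .three q < _; omega, by omega,
      fun h => by rw [h]; push_cast; rfl, rfl⟩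
  · exact ⟨.one, by change hi .two q < _; omega, hlst, fun h => by rw [h]; push_cast; rfl, rfl⟩

lemma exists_reducesTo_three (hlo : lo .three (q + 3) < n) (hhi : n ≤ hi .three (q + 3)) :
    ∃ j', ReducesTo .three q n j' := by
  have hy : (n : ℤ) - (ofLevel (q + 7)).y = (n - t (q + 6) : ℕ) :=
    (Nat.cast_sub ((t_le_lo .three (q + 3)).trans hlo.le)).symm
  have hm : ¬ (ofLevel (q + 7)).m ≤ 6 := by simp only [ofLevel]; omega
  have hθ₂ : (ofLevel (q + 7)).θ2 = t (q + 6) + hi .three q + 1 := toTwo_ofLevel .three q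
  have hθ₃ : (ofLevel (q + 7)).θ3 = t (q + 6) + hi .two q + 1 := toOne_ofLevel .three q
  have hθ₁ : ((ofLevel (q + 7)).θ1 : ℚ) = gMin .three (q + 7) 1 := by
    rw [← (blocks_explicit (m := q + 7) (by omega)).1.1, Int.cast_natCast]
  have hpart := part_three (m := q + 7) (by omega) (mem_block_iff.2 ⟨hlo, hhi⟩)
  have hfst : lo .three q < n - t (q + 6) := lo_three q ▸ lcpLength_lt_sub (j := .three) hlo
  have hlst : n - t (q + 6) ≤ hi .one q := hi_one q ▸ sub_le_lcpLength (j := .three) hhi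
  simp only [Nat.reduceSubDiff] at hpart
  simp only [ReducesTo, depth, add_assoc, Nat.reduceAdd]
  rw [hpart, partAlg, if_neg hm]
  simp only [down_down_down_ofLevel (q + 2), hy, hθ₁, ← bSum_eq_sumForm]
  split_ifs with h₁ h₂ h₃
  · exact ⟨.three, hfst, by omega, fun h => by rw [h]; push_cast; rfl, rfl⟩
  · exact ⟨.two, by change hi .three q < _; omega, by omega,
      fun h => by rw [h]; push_cast; rfl, rfl⟩
  · exact ⟨.one, by change hi .two q < _; omega, hlst, fun h => by rw [h]; push_cast; rfl, rfl⟩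
  · exact ⟨.one, by change hi .two q < _; omega, hlst, fun h => by rw [h]; rfl, rfl⟩

lemma exists_reducesTo (hlo : lo j (q + depth j) < n) (hhi : n ≤ hi j (q + depth j)) :
    ∃ j', ReducesTo j q n j' := by
  cases j
  · exact exists_reducesTo_one hlo hhi
  · exact exists_reducesTo_two hlo hhi
  · exact exists_reducesTo_three hlo hhi

theorem partAlg_eq (hlo : lo j r < n) (hhi : n ≤ hi j r) :
    (partAlg j (ofLevel (r + 4)) n).1 = part j (r + 4) n ∧
      (partAlg j (ofLevel (r + 4)) n).2 ≤ r := by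
  induction r using Nat.strong_induction_on generalizing j n with
  | _ r ih =>
    obtain hr | hr := lt_or_ge r (depth j)
    · rw [partAlg_of_lt_depth hr, part_eq_initSum hr hhi]
      exact ⟨rfl, Nat.zero_le r⟩
    obtain ⟨q, rfl⟩ := Nat.exists_eq_add_of_le' hr
    obtain ⟨j', hlo', hhi', hvalue, hsteps⟩ := exists_reducesTo hlo hhi
    have hdepth : 0 < depth j := by cases j <;> decide
    obtain ⟨ihvalue, ihsteps⟩ := ih q (Nat.lt_add_of_pos_right hdepth) hlo' hhi'
    exact ⟨hvalue ihvalue, by omega⟩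

lemma beforeForm_ofLevel (hr : j = .three → r ≠ 0) :
    beforeForm j (ofLevel (r + 4)) = B (lo j r) := by
  cases j
  · exact (B_hi_eq_maxForm .two r).symm
  · exact (B_hi_eq_maxForm .three r).symm
  · obtain ⟨q, rfl⟩ := Nat.exists_eq_succ_of_ne_zero (hr rfl)
    rw [beforeForm, down_ofLevel (q + 2), lo_three, ← hi_one q]
    exact (B_hi_eq_maxForm .one q).symm

theorem algB_eq (hn : 52 ≤ n) (h : lcpLength (r + 3) < n) (h' : n ≤ lcpLength (r + 4)) :
    (algB n).1 = B n ∧ (algB n).2 ≤ 2 * r := by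
  obtain ⟨hlo, hhi⟩ := idx_spec h h'
  have hr := lt_level_of_lcpLength_lt (s := 6) (lcpLength_values.2.2.2.trans_lt hn) hhi
  rw [algB, if_neg (by omega)]
  simp only [level_eq h h']
  obtain ⟨hvalue, hsteps⟩ := partAlg_eq hlo hhi
  exact ⟨by rw [hvalue, beforeForm_ofLevel (by omega), part_eq hlo.le, add_sub_cancel], by omega⟩

theorem algB_correct (n : ℕ) : (algB n).1 = B n := by
  obtain hn | hn := le_or_gt n 51
  · rw [algB, if_pos hn, B_eq_sum]
    simp only [bAlg_eq, Int.cast_natCast, Nat.cast_sum]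
  · obtain ⟨r, hr, hr'⟩ := exists_level (n := n) (by omega)
    exact (algB_eq hn hr hr').1

lemma two_mul_t_le (m : ℕ) : 2 * t m ≤ t (m + 2) := by
  match m with
  | 0 => decide
  | m + 1 =>
    have : t (m + 1) < t (m + 2) := t_strictMono (Nat.lt_add_one _)
    rw [t_add_three]
    omega

lemma two_pow_le_t (q : ℕ) : 2 ^ q ≤ t (2 * q) := by
  induction q with
  | zero => decide
  | succ q ih =>
    rw [pow_succ']
    exact (Nat.mul_le_mul_left 2 ih).trans (two_mul_t_le (2 * q))

lemma level_le_log (h : lcpLength (r + 3) < n) : r ≤ 2 * Nat.log 2 n + 1 := by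
  have hpow : 2 ^ (r / 2) ≤ n := calc
    2 ^ (r / 2) ≤ t (2 * (r / 2)) := two_pow_le_t _
    _ ≤ t (r + 3) := t_strictMono.monotone (by omega)
    _ ≤ lcpLength (r + 3) + 1 := t_le_lcpLength_add_one _
    _ ≤ n := h
  have := Nat.le_log_of_pow_le one_lt_two hpow
  omega

theorem exists_algB_steps_le : ∃ C : ℕ, ∀ n : ℕ, (algB n).2 ≤ C * (Nat.log 2 n + 1) := by
  refine ⟨∑ n ∈ Finset.range 52, (algB n).2 + 4, fun n => ?_⟩
  obtain hn | hn := lt_or_ge n 52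
  · calc (algB n).2 ≤ ∑ n ∈ Finset.range 52, (algB n).2 :=
          Finset.single_le_sum (f := fun n => (algB n).2) (fun _ _ => Nat.zero_le _)
            (Finset.mem_range.2 hn)
      _ ≤ ∑ n ∈ Finset.range 52, (algB n).2 + 4 := Nat.le_add_right _ _
      _ ≤ _ := Nat.le_mul_of_pos_right _ (Nat.succ_pos _)
  · obtain ⟨r, hr, hr'⟩ := exists_level (n := n) (by omega)
    calc (algB n).2 ≤ 2 * r := (algB_eq hn hr hr').2
      _ ≤ 4 * (Nat.log 2 n + 1) := by have := level_le_log hr; omega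
      _ ≤ _ := Nat.mul_le_mul_right _ (Nat.le_add_left _ _)

end Algorithms

end TribSq

open TribSq in
theorem mainTheorem5 :
    -- `B` is the summatory function of `b`
    (∀ n : ℕ, B n = ∑ i ∈ Finset.Icc 1 n, b i) ∧
    -- the blocks `Γ_{j,m,1}`: explicit end points and lengths
    (∀ m : ℕ, 4 ≤ m →
      ((gMin .three m 1 : ℤ) = (Trip.ofLevel m).θ1 ∧ (gMax .three m 1 : ℤ) + 1 = (Trip.ofLevel m).θ4) ∧
      ((gMin .two m 1 : ℤ) = (Trip.ofLevel m).θ4 ∧ (gMax .two m 1 : ℤ) + 1 = (Trip.ofLevel m).θ7) ∧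
      ((gMin .one m 1 : ℤ) = (Trip.ofLevel m).θ7 ∧ (gMax .one m 1 : ℤ) + 1 = (Trip.ofLevel m).θ10) ∧
      (block .one m 1).length = t (m - 2) ∧
      (block .two m 1).length = t (m - 3) ∧
      (block .three m 1).length = t (m - 4)) ∧
    -- they partition the positions `n ≥ 8`, and the levels of large positions are large
    (∀ n : ℕ, 8 ≤ n → ∃! q : Idx × ℕ, 4 ≤ q.2 ∧ n ∈ block q.1 q.2 1) ∧
    (∀ (n m : ℕ) (j : Idx), 4 ≤ m → n ∈ block j m 1 →
      (52 ≤ n → 7 ≤ m) ∧ (32 ≤ n → j = .two → 6 ≤ m) ∧ (21 ≤ n → j = .one → 5 ≤ m)) ∧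
    -- the recursive description of `b`
    ((∀ i ≤ 7, b i = 0) ∧ [8].map b = [1] ∧ [9, 10].map b = [0, 1] ∧
      [11, 12, 13, 14].map b = [0, 0, 0, 1] ∧ [15, 16].map b = [1, 1] ∧
      [17, 18, 19, 20].map b = [0, 0, 1, 1] ∧ [28, 29, 30, 31].map b = [1, 1, 1, 1]) ∧
    (∀ m : ℕ, 5 ≤ m → bVec .one m = List.zipWith (· + ·) (bCat (m - 1))
      (List.replicate (t (m - 2) + 1 - k m) 0 ++ List.replicate (k m - 1) 1)) ∧
    (∀ m : ℕ, 6 ≤ m → bVec .two m = List.zipWith (· + ·) (bCat (m - 2))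
      (List.replicate (t (m - 3) + 1 - k m) 0 ++ List.replicate (k m - 1) 1)) ∧
    (∀ m : ℕ, 7 ≤ m → bVec .three m = List.zipWith (· + ·) (bCat (m - 3))
      (List.replicate (t (m - 4) + 1 - k (m - 3)) 1 ++ List.replicate (k (m - 3) - 1) 0)) ∧
    -- the closed forms
    (∀ m : ℕ, 4 ≤ m →
      (Phi m : ℚ) = (Trip.ofLevel m).phiForm ∧
      (∀ j : Idx, (bSum j m : ℚ) = (Trip.ofLevel m).sumForm j) ∧
      (∑ i ∈ Finset.Icc 4 (m - 1), (Phi i : ℚ)) = (Trip.ofLevel m).phiSumForm ∧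
      (∀ j : Idx, (B (gMax j m 1) : ℚ) = (Trip.ofLevel m).maxForm j)) ∧
    -- the thresholds and the shift by `t_{m-1}`
    (∀ m : ℕ, 7 ≤ m →
      (Trip.ofLevel m).θ2 = gMin .three m 1 + (block .three (m - 3) 1).length ∧
      (Trip.ofLevel m).θ3 = gMin .three m 1 + (block .three (m - 3) 1).length
        + (block .two (m - 3) 1).length ∧
      (Trip.ofLevel m).η1 = gMin .three m 1 + t (m - 4) - k (m - 3) + 1 ∧
      (Trip.ofLevel m).θ3 < (Trip.ofLevel m).η1 ∧ (Trip.ofLevel m).η1 < (Trip.ofLevel m).θ4 ∧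
      gMin .three m 1 = gMin .three (m - 3) 1 + t (m - 1)) ∧
    (∀ m : ℕ, 6 ≤ m →
      (Trip.ofLevel m).θ5 = gMin .two m 1 + (block .three (m - 2) 1).length ∧
      (Trip.ofLevel m).η2 = gMin .two m 1 + t (m - 3) - k m + 1 ∧
      (Trip.ofLevel m).θ6 = gMin .two m 1 + (block .three (m - 2) 1).length
        + (block .two (m - 2) 1).length ∧
      (Trip.ofLevel m).θ5 < (Trip.ofLevel m).η2 ∧ (Trip.ofLevel m).η2 ≤ (Trip.ofLevel m).θ6 ∧
      gMin .two m 1 = gMin .three (m - 2) 1 + t (m - 1)) ∧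
    (∀ m : ℕ, 5 ≤ m →
      (Trip.ofLevel m).θ8 = gMin .one m 1 + (block .three (m - 1) 1).length ∧
      (Trip.ofLevel m).θ9 = gMin .one m 1 + (block .three (m - 1) 1).length
        + (block .two (m - 1) 1).length ∧
      (Trip.ofLevel m).η3 = gMin .one m 1 + t (m - 2) - k m + 1 ∧
      (Trip.ofLevel m).θ9 < (Trip.ofLevel m).η3 ∧ (Trip.ofLevel m).η3 < (Trip.ofLevel m).θ10 ∧
      gMin .one m 1 = gMin .three (m - 1) 1 + t (m - 1)) ∧
    -- the reduction of the partial block sums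
    (∀ n m : ℕ, 7 ≤ m → n ∈ block .three m 1 →
      part .three m n =
        if (n : ℤ) < (Trip.ofLevel m).θ2 then
          part .three (m - 3) (n - t (m - 1)) + n - gMin .three m 1 + 1
        else if (n : ℤ) < (Trip.ofLevel m).θ3 then
          part .two (m - 3) (n - t (m - 1)) + bSum .three (m - 3) + n - gMin .three m 1 + 1
        else if (n : ℤ) < (Trip.ofLevel m).η1 then
          part .one (m - 3) (n - t (m - 1)) + bSum .three (m - 3) + bSum .two (m - 3)
            + n - gMin .three m 1 + 1
        else
          part .one (m - 3) (n - t (m - 1)) + bSum .three (m - 3) + bSum .two (m - 3)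
            + (-5 * (t m : ℚ) + 10 * t (m - 1) - t (m - 2) + 1) / 2) ∧
    (∀ n m : ℕ, 6 ≤ m → n ∈ block .two m 1 →
      part .two m n =
        if (n : ℤ) < (Trip.ofLevel m).θ5 then
          part .three (m - 2) (n - t (m - 1))
        else if (n : ℤ) < (Trip.ofLevel m).η2 then
          part .two (m - 2) (n - t (m - 1)) + bSum .three (m - 2)
        else if (n : ℤ) < (Trip.ofLevel m).θ6 then
          part .two (m - 2) (n - t (m - 1)) + bSum .three (m - 2) + n - (Trip.ofLevel m).η2 + 1
        else
          part .one (m - 2) (n - t (m - 1)) + bSum .three (m - 2) + bSum .two (m - 2)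
            + n - (Trip.ofLevel m).η2 + 1) ∧
    (∀ n m : ℕ, 5 ≤ m → n ∈ block .one m 1 →
      part .one m n =
        if (n : ℤ) < (Trip.ofLevel m).θ8 then
          part .three (m - 1) (n - t (m - 1))
        else if (n : ℤ) < (Trip.ofLevel m).θ9 then
          part .two (m - 1) (n - t (m - 1)) + bSum .three (m - 1)
        else if (n : ℤ) < (Trip.ofLevel m).η3 then
          part .one (m - 1) (n - t (m - 1)) + bSum .three (m - 1) + bSum .two (m - 1)
        else
          part .one (m - 1) (n - t (m - 1)) + bSum .three (m - 1) + bSum .two (m - 1)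
            + n - (Trip.ofLevel m).η3 + 1) ∧
    -- `B(n)` from the preceding block and the partial block sum
    (∀ (n m : ℕ) (j : Idx), 4 ≤ m → n ∈ block j m 1 →
      (B n : ℚ) = B (gMin j m 1 - 1) + part j m n) ∧
    -- the algorithms are correct, and the one for `B` takes `O(log n)` steps
    (∀ n : ℕ, (bAlg n).1 = b n) ∧
    (∀ n : ℕ, (algB n).1 = B n) ∧
    (∃ C : ℕ, ∀ n : ℕ, (algB n).2 ≤ C * (Nat.log 2 n + 1)) := by
  exact ⟨B_eq_sum, fun m hm => blocks_explicit hm, fun n => existsUnique_block,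
    fun n m j hm hn => level_ge hm hn, b_initial, fun m hm => bVec_one hm,
    fun m hm => bVec_two hm, fun m hm => bVec_three hm, fun m hm => closed_forms hm,
    fun m hm => thresholds_three hm, fun m hm => thresholds_two hm, fun m hm => thresholds_one hm,
    fun n m hm hn => part_three hm hn, fun n m hm hn => part_two hm hn,
    fun n m hm hn => part_one hm hn, fun n m j hm hn => B_eq_B_add_part hm hn,
    bAlg_eq, algB_correct, exists_algB_steps_le⟩
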